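/- A convex polytope in $\mathbb R^3$ is the convex hull of finitely many points with nonempty interior; it is simplicial if all its two-dimensional faces are triangles. A continuous deformation of a convex polytope $P$ with vertex set $V$ is a family of convex polytopes $\{P_t : t\in[0,1]\}$ in $\mathbb R^3$ with $P_0=P$, together with continuous maps $t\mapsto v(t)\in\mathbb R^3$ for $v\in V$ with $v(0)=v$, such that for every $t\in[0,1]$: (i) $v\mapsto v(t)$ is a bijection from $V$ onto the vertex set of $P_t$, and a subset $S\subseteq V$ is the vertex set of a face of $P$ if and only if $\{v(t): v\in S\}$ is the vertex set of a face of $P_t$ (same combinatorial structure); (ii) $|u(t)-v(t)|=|u-v|$ for every edge $uv$ of $P$ (same edge lengths). **Corollary (Cauchy).** Every simplicial convex polytope $P$ in $\mathbb R^3$ is continuously rigid: every continuous deformation of $P$ is a rigid motion. That is, for every continuous deformation $\{P_t\}$ of $P$ there is a family $g_t$, $t\in[0,1]$, of orientation-preserving isometries of $\mathbb R^3$, with $g_t(x)$ continuous in $t$ for every $x\in\mathbb R^3$ and $g_0=\mathrm{id}$, such that $P_t=g_t(P)$ and $v(t)=g_t(v)$ for all $t\in[0,1]$ and $v\in V$.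 -/

import Mathlib

/-- Euclidean three-space. -/
abbrev E3 : Type := EuclideanSpace ℝ (Fin 3)

namespace Polytope3

/-- A convex polytope in `ℝ³`: the convex hull of finitely many points, with nonempty interior
(that is, three-dimensional). -/
def IsConvexPolytope (P : Set E3) : Prop :=
  (∃ s : Set E3, s.Finite ∧ P = convexHull ℝ s) ∧ (interior P).Nonempty

/-- The vertices of `P`. -/
def vertices (P : Set E3) : Set E3 := P.extremePoints ℝ

/-- `F` is a face of `P`: the set of maximizers on `P` of a linear functional, or the empty set.
The polytope `P` itself is a face. -/
def IsFace (P F : Set E3) : Prop := IsExposed ℝ P F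

/-- Two distinct vertices `u`, `v` of `P` are joined by an edge: the segment `[u, v]` is a face. -/
def IsEdge (P : Set E3) (u v : E3) : Prop :=
  u ∈ vertices P ∧ v ∈ vertices P ∧ u ≠ v ∧ IsFace P (segment ℝ u v)

/-- A facet of `P`: a two-dimensional face. -/
def IsFacet (P F : Set E3) : Prop :=
  IsFace P F ∧ Module.finrank ℝ (vectorSpan ℝ F) = 2

/-- A nondegenerate triangle. -/
def IsTriangle (F : Set E3) : Prop :=
  ∃ p : Fin 3 → E3, AffineIndependent ℝ p ∧ F = convexHull ℝ (Set.range p)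

/-- `P` is simplicial: all its facets are triangles. -/
def IsSimplicial (P : Set E3) : Prop :=
  ∀ F : Set E3, IsFacet P F → IsTriangle F

/-- `S` is the set of all vertices of `P` that lie on some face of `P`. -/
def IsFaceVertexSet (P S : Set E3) : Prop :=
  ∃ F : Set E3, IsFace P F ∧ S = F ∩ vertices P

/-- The map `f` from the vertices of `P` to points of space identifies the combinatorial structure
(the face lattice) of `P` with that of `Q`: it is a bijection from the vertices of `P` onto those
of `Q`, and a set of vertices of `P` spans a face of `P` if and only if the corresponding set of
vertices spans a face of `Q`. -/
def SameCombinatorics (P Q : Set E3) (f : vertices P → E3) : Prop :=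
  Function.Injective f ∧ Set.range f = vertices Q ∧
    ∀ S : Set (vertices P),
      IsFaceVertexSet P (Subtype.val '' S) ↔ IsFaceVertexSet Q (f '' S)

/-- A continuous deformation `{P_t : t ∈ [0,1]}` of `P = P_0`. -/
structure ContinuousDeformation (P : Set E3) where
  /-- the polytope `P_t` -/
  body : unitInterval → Set E3
  /-- `vert t v` is the position at time `t` of the vertex that starts at `v` -/
  vert : unitInterval → vertices P → E3
  body_zero : body 0 = P
  vert_zero : ∀ v : vertices P, vert 0 v = v
  isConvexPolytope : ∀ t, IsConvexPolytope (body t)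
  sameCombinatorics : ∀ t, SameCombinatorics P (body t) (vert t)
  edge_length : ∀ t, ∀ u v : vertices P, IsEdge P u v →
    dist (vert t u) (vert t v) = dist (u : E3) (v : E3)
  continuous_vert : ∀ v : vertices P, Continuous fun t => vert t v

/-- The deformation is a rigid motion in `ℝ³`: it is the restriction to `P` of a continuous family,
starting at the identity, of orientation-preserving isometries of `ℝ³`. -/
def ContinuousDeformation.IsRigidMotion {P : Set E3} (D : ContinuousDeformation P) : Prop :=
  ∃ g : unitInterval → (E3 ≃ᵃⁱ[ℝ] E3),
    g 0 = AffineIsometryEquiv.refl ℝ E3 ∧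
    (∀ x : E3, Continuous fun t => g t x) ∧
    (∀ t, LinearMap.det ((g t).linearIsometryEquiv.toLinearEquiv : E3 →ₗ[ℝ] E3) = 1) ∧
    (∀ t, D.body t = g t '' P) ∧
    ∀ t, ∀ v : vertices P, D.vert t v = g t v

/-- `P` is continuously rigid: every continuous deformation of `P` is a rigid motion. -/
def IsContinuouslyRigid (P : Set E3) : Prop :=
  ∀ D : ContinuousDeformation P, D.IsRigidMotion

end Polytope3

/-!
Rigidity of simplicial polytopes follows from Dehn's theorem, the infinitesimal version, by an
elementary averaging argument.

**Dehn's theorem** (`SimplicialVertexSet.flex_eq_zero`). Let velocities `a v` be given at the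
vertices which preserve all edge lengths to first order and vanish on one facet. Call a vertex dead
if its velocity is zero and live otherwise. The sign of `⟪a v, w - v⟫`, which changes when `v` and
`w` are exchanged, orients the edges. Two counts of sign changes in the angles of the facets
contradict each other, an edge with value zero being counted as half a sign change in each adjacent
angle.

* At a live vertex `v`, the plane through `v` orthogonal to `a v` meets the convex cone at `v` in a
  planar cone, which has at most two boundary rays. Hence there are at most two sign changes
  (`SimplicialVertexSet.sum_angleWeight_le_four`).
* A facet that is not entirely dead has at least one sign change at its live vertices
  (`two_le_sum_angleWeight`).
* More than `2 * m` facets are not entirely dead, where `m` is the number of live vertices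
  (`SimplicialVertexSet.two_mul_card_sdiff_lt`).

The last fact replaces Euler's formula and planarity. It comes from the same count for a
translation, that is, for a functional `h` that separates the vertices: every facet has exactly one
middle vertex with respect to `h`, a vertex is the middle of at most two facets, and of two if it is
not extreme for `h`. The latter (`SimplicialVertexSet.two_le_card_crosses`) is where facets are
produced, by tilting a supporting plane as far as possible.

**From infinitesimal to continuous rigidity.** Composed with the inverses of the isometries that
follow one facet (`exists_isometry_family`), the deformation fixes that facet. If `p` and `q` are
two positions of the vertices with equal edge lengths, then `q - p` is an infinitesimal flex of
`q + p`. For `q` close to `p`, the position `q + p` is close to `2 p`, so it has no such flex apart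
from zero, because that property is open. So the times at which the vertices are at their original
places form an open and closed subset of `[0, 1]` (`SimplicialVertexSet.eq_of_continuous`).
-/

/-! ### Exposed sets of vertices -/

open Finset in
/-- Three vectors in the kernel of a nonzero linear functional on `ℝ³` are linearly dependent. -/
theorem exists_relation_of_mem_ker {f : Module.Dual ℝ E3} (hf : f ≠ 0) (x : Fin 3 → E3)
    (hx : ∀ i, f (x i) = 0) : ∃ c : Fin 3 → ℝ, c ≠ 0 ∧ ∑ i, c i • x i = 0 := by
  have hfin : Module.finrank ℝ (LinearMap.ker f) = 2 := by
    have := Module.Dual.finrank_ker_add_one_of_ne_zero hf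
    simp at this
    omega
  let y : Fin 3 → LinearMap.ker f := fun i => ⟨x i, by simpa using hx i⟩
  have hy : ¬ LinearIndependent ℝ y := by
    intro h
    have := h.fintype_card_le_finrank
    rw [hfin] at this
    simp at this
  rw [Fintype.not_linearIndependent_iff] at hy
  obtain ⟨c, hc, i, hi⟩ := hy
  refine ⟨c, fun h => hi (by simp [h]), ?_⟩
  have := congrArg (LinearMap.ker f).subtype hc
  simpa [y] using this

/-- Among three rays of a pointed cone lying in a plane, one is a nonnegative combination of the
other two, so they cannot all be exposed. -/
theorem false_of_three_exposed_in_plane {f g : Module.Dual ℝ E3} (hf : f ≠ 0) (x : Fin 3 → E3)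
    (hfx : ∀ i, f (x i) = 0) (hgx : ∀ i, 0 < g (x i)) (l : Fin 3 → Module.Dual ℝ E3)
    (hl : ∀ i, l i (x i) = 0) (hl' : ∀ i j, j ≠ i → l i (x j) < 0) : False := by
  obtain ⟨c, hc, hrel⟩ := exists_relation_of_mem_ker hf x hfx
  have key : ∀ m : Module.Dual ℝ E3, c 0 * m (x 0) + c 1 * m (x 1) + c 2 * m (x 2) = 0 := by
    intro m
    have := congrArg m hrel
    simpa [Fin.sum_univ_three] using this
  have hg := key g
  have k0 := key (l 0)
  have k1 := key (l 1)
  have k2 := key (l 2)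
  rw [hl 0] at k0
  rw [hl 1] at k1
  rw [hl 2] at k2
  have p0 := hgx 0
  have p1 := hgx 1
  have p2 := hgx 2
  have h01 := hl' 0 1 (by decide)
  have h02 := hl' 0 2 (by decide)
  have h10 := hl' 1 0 (by decide)
  have h12 := hl' 1 2 (by decide)
  have h20 := hl' 2 0 (by decide)
  have h21 := hl' 2 1 (by decide)
  -- two coefficients have the same weak sign; the functional exposing the third ray kills both
  have aux : ∀ a b p q : ℝ, p < 0 → q < 0 → a * p + b * q = 0 → 0 ≤ a * b → a = 0 ∧ b = 0 := by
    intro a b p q hp hq h hab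
    have h1 : a * (a * p + b * q) = 0 := by rw [h]; ring
    have h2 : b * (a * p + b * q) = 0 := by rw [h]; ring
    have ha : a * a = 0 := by
      nlinarith [mul_self_nonneg a, mul_self_nonneg b, mul_nonneg hab (neg_pos.2 hq).le,
        mul_nonneg (mul_self_nonneg a) (neg_pos.2 hp).le]
    have hb : b * b = 0 := by
      nlinarith [mul_self_nonneg a, mul_self_nonneg b, mul_nonneg hab (neg_pos.2 hp).le,
        mul_nonneg (mul_self_nonneg b) (neg_pos.2 hq).le]
    exact ⟨mul_self_eq_zero.1 ha, mul_self_eq_zero.1 hb⟩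
  have fin : c 0 = 0 → c 1 = 0 → c 2 = 0 → False := by
    intro a b d
    apply hc
    funext i
    fin_cases i <;> assumption
  have pos : 0 ≤ c 1 * c 2 ∨ 0 ≤ c 0 * c 2 ∨ 0 ≤ c 0 * c 1 := by
    by_contra! h
    obtain ⟨h1, h2, h3⟩ := h
    nlinarith [mul_pos_of_neg_of_neg h1 h2, mul_self_nonneg (c 2)]
  rcases pos with h | h | h
  · obtain ⟨e1, e2⟩ := aux _ _ _ _ h01 h02 (by linarith) h
    rw [e1, e2] at hg
    exact fin (by nlinarith) e1 e2
  · obtain ⟨e1, e2⟩ := aux _ _ _ _ h10 h12 (by linarith) h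
    rw [e1, e2] at hg
    exact fin e1 (by nlinarith) e2
  · obtain ⟨e1, e2⟩ := aux _ _ _ _ h20 h21 (by linarith) h
    rw [e1, e2] at hg
    exact fin e1 e2 (by nlinarith)

theorem exists_dual_of_not_mem_span (r s : E3) (h : s ∉ Submodule.span ℝ {r}) :
    ∃ φ : Module.Dual ℝ E3, φ r = 0 ∧ φ s = 1 := by
  obtain ⟨f, hf, hle⟩ := Submodule.exists_le_ker_of_notMem h
  refine ⟨(f s)⁻¹ • f, ?_, ?_⟩
  · have : f r = 0 := by
      have := hle (Submodule.mem_span_singleton_self r)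
      simpa using this
    simp [this]
  · simp [hf]

/-- On a finite set where `ψ` is positive, a large multiple of `ψ` dominates `φ`. -/
theorem exists_forall_lt_mul {α : Type*} (S : Finset α) (φ ψ : α → ℝ) (h : ∀ x ∈ S, 0 < ψ x) :
    ∃ K : ℝ, ∀ x ∈ S, φ x < K * ψ x := by
  have : ∀ᶠ K : ℝ in Filter.atTop, ∀ x ∈ S, φ x < K * ψ x := by
    rw [Filter.eventually_all_finset]
    intro x hx
    filter_upwards [Filter.eventually_gt_atTop (φ x / ψ x)] with K hK
    rwa [div_lt_iff₀ (h x hx)] at hK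
  exact this.exists

/-- The data of a simplicial polytope in `ℝ³` with vertex set `V`, phrased with linear
functionals: every point of `V` is the unique minimizer of some functional, a supporting plane
contains at most three points of `V`, and `V` is not coplanar. -/
structure SimplicialVertexSet (V : Finset E3) : Prop where
  exposed : ∀ v ∈ V, ∃ g : Module.Dual ℝ E3, ∀ w ∈ V, w ≠ v → g v < g w
  card_le_three : ∀ l : Module.Dual ℝ E3, l ≠ 0 → ∀ c : ℝ, (∀ x ∈ V, l x ≤ c) →
    (V.filter fun x => l x = c).card ≤ 3
  exists_ne : ∀ l : Module.Dual ℝ E3, l ≠ 0 → ∀ c : ℝ, ∃ x ∈ V, l x ≠ c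

/-- `A` is the set of maximizers on `V` of a linear functional. -/
def IsExposedSubset (V A : Finset E3) : Prop :=
  A ⊆ V ∧ ∃ l : Module.Dual ℝ E3, ∃ c : ℝ, (∀ x ∈ A, l x = c) ∧ ∀ x ∈ V, x ∉ A → l x < c

open Classical in
/-- The facets of `V`: exposed subsets with three elements. -/
noncomputable def facets (V : Finset E3) : Finset (Finset E3) :=
  V.powerset.filter fun τ => τ.card = 3 ∧ IsExposedSubset V τ

theorem mem_facets {V τ : Finset E3} : τ ∈ facets V ↔ τ.card = 3 ∧ IsExposedSubset V τ := by
  simp only [facets, Finset.mem_filter, Finset.mem_powerset, and_iff_right_iff_imp]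
  exact fun h => h.2.1

open Classical in
/-- Three distinct exposed sets at a vertex, none inside another, cannot each have a positive
combination of their edge vectors in one plane through the vertex. -/
theorem card_exposed_in_plane_le_two {V : Finset E3} (hV : SimplicialVertexSet V) {v : E3}
    (hv : v ∈ V) {f : Module.Dual ℝ E3} (hf : f ≠ 0) (𝓐 : Finset (Finset E3))
    (hanti : ∀ A ∈ 𝓐, ∀ B ∈ 𝓐, A ⊆ B → A = B)
    (h𝓐 : ∀ A ∈ 𝓐, v ∉ A ∧ A.Nonempty ∧ IsExposedSubset V (insert v A) ∧
      ∃ c : E3 → ℝ, (∀ w ∈ A, 0 < c w) ∧ ∑ w ∈ A, c w * f (w - v) = 0) : 𝓐.card ≤ 2 := by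
  by_contra! hcard
  obtain ⟨A, hA, B, hB, C, hC, hAB, hAC, hBC⟩ := Finset.two_lt_card.1 hcard
  obtain ⟨g, hg⟩ := hV.exposed v hv
  let S : Fin 3 → Finset E3 := ![A, B, C]
  have hS : ∀ i, S i ∈ 𝓐 := by
    intro i
    fin_cases i <;> assumption
  have hne : ∀ i j, j ≠ i → S j ≠ S i := by
    intro i j hij
    fin_cases i <;> fin_cases j <;> simp_all [S, Ne.symm]
  choose hvA hAne hexp c hcpos hcsum using fun i => h𝓐 (S i) (hS i)
  choose hsub l k hl hl' using hexp
  have hSV : ∀ i, ∀ w ∈ S i, w ∈ V := fun i w hw => hsub i (Finset.mem_insert_of_mem hw)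
  have hk : ∀ i, k i = l i v := fun i => (hl i v (Finset.mem_insert_self _ _)).symm
  have hle : ∀ i, ∀ w ∈ V, l i (w - v) ≤ 0 := by
    intro i w hw
    rw [map_sub, ← hk]
    by_cases h : w ∈ insert v (S i)
    · simp [hl i w h]
    · linarith [hl' i w hw h]
  refine false_of_three_exposed_in_plane hf (g := g) (fun i => ∑ w ∈ S i, c i w • (w - v))
    ?_ ?_ l ?_ ?_
  · intro i
    simpa [map_sum] using hcsum i
  · intro i
    simp only [map_sum, map_smul, smul_eq_mul]
    refine Finset.sum_pos (fun w hw => mul_pos (hcpos i w hw) ?_) (hAne i)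
    rw [map_sub, sub_pos]
    exact hg w (hSV i w hw) (fun h => hvA i (h ▸ hw))
  · intro i
    simp only [map_sum, map_smul, smul_eq_mul]
    refine Finset.sum_eq_zero fun w hw => ?_
    rw [map_sub, hl i w (Finset.mem_insert_of_mem hw), hk, sub_self, mul_zero]
  · intro i j hij
    simp only [map_sum, map_smul, smul_eq_mul]
    have : ∃ w ∈ S j, w ∉ S i := by
      by_contra! h
      exact hne i j hij (hanti _ (hS j) _ (hS i) h)
    obtain ⟨w, hw, hwi⟩ := this
    refine Finset.sum_neg' (fun w hw => mul_nonpos_of_nonneg_of_nonpos (hcpos j w hw).le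
      (hle i w (hSV j w hw))) ⟨w, hw, mul_neg_of_pos_of_neg (hcpos j w hw) ?_⟩
    rw [map_sub, ← hk, sub_neg]
    refine hl' i w (hSV j w hw) ?_
    simp only [Finset.mem_insert, not_or]
    exact ⟨fun h => hvA j (h ▸ hw), hwi⟩

/-- No three exposed points are collinear. -/
theorem sub_notMem_span_of_exposed {V : Set E3}
    (hV : ∀ v ∈ V, ∃ g : Module.Dual ℝ E3, ∀ w ∈ V, w ≠ v → g v < g w)
    {u v w : E3} (hu : u ∈ V) (hv : v ∈ V) (hw : w ∈ V) (huv : u ≠ v) (huw : u ≠ w)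
    (hvw : v ≠ w) : w - u ∉ Submodule.span ℝ {v - u} := by
  rw [Submodule.mem_span_singleton]
  rintro ⟨t, ht⟩
  have key : ∀ g : Module.Dual ℝ E3, t * (g v - g u) = g w - g u := by
    intro g
    have := congrArg g ht
    simpa using this
  obtain ⟨g, hg⟩ := hV u hu
  have a1 := hg v hv huv.symm
  have a2 := hg w hw huw.symm
  have a3 := key g
  have ht0 : 0 < t := by
    by_contra! h
    nlinarith
  rcases lt_trichotomy t 1 with h | h | h
  · obtain ⟨g, hg⟩ := hV w hw
    have b1 := hg v hv hvw
    have b2 := hg u hu huw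
    have b3 := key g
    nlinarith
  · subst h
    apply hvw
    have := ht
    rw [one_smul] at this
    exact sub_left_injective this
  · obtain ⟨g, hg⟩ := hV v hv
    have b1 := hg w hw hvw.symm
    have b2 := hg u hu huv
    have b3 := key g
    nlinarith

theorem SimplicialVertexSet.sub_notMem_span {V : Finset E3} (hV : SimplicialVertexSet V)
    {u v w : E3} (hu : u ∈ V) (hv : v ∈ V) (hw : w ∈ V) (huv : u ≠ v) (huw : u ≠ w)
    (hvw : v ≠ w) : w - u ∉ Submodule.span ℝ {v - u} :=
  sub_notMem_span_of_exposed (V := V) hV.exposed hu hv hw huv huw hvw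

open Classical in
/-- An edge of a facet is exposed: tilt the supporting plane of the facet about the edge. -/
theorem SimplicialVertexSet.isExposedSubset_pair {V : Finset E3} (hV : SimplicialVertexSet V)
    {τ : Finset E3} (hτ : τ ∈ facets V) {u v : E3} (hu : u ∈ τ) (hv : v ∈ τ) (huv : u ≠ v) :
    IsExposedSubset V {u, v} := by
  obtain ⟨hcard, hsub, l, c, hl, hl'⟩ := mem_facets.1 hτ
  obtain ⟨w, hw, hwu, hwv⟩ : ∃ w ∈ τ, w ≠ u ∧ w ≠ v := by
    obtain ⟨w, hw, h⟩ := Finset.exists_mem_notMem_of_card_lt_card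
      (show ({u, v} : Finset E3).card < τ.card by rw [Finset.card_pair huv, hcard]; norm_num)
    simp only [Finset.mem_insert, Finset.mem_singleton, not_or] at h
    exact ⟨w, hw, h⟩
  have hτeq : τ = {u, v, w} := by
    symm
    apply Finset.eq_of_subset_of_card_le
    · simp [Finset.insert_subset_iff, hu, hv, hw]
    · rw [hcard, Finset.card_eq_three.2 ⟨u, v, w, huv, hwu.symm, hwv.symm, rfl⟩]
  obtain ⟨φ, hφ, hφ'⟩ := exists_dual_of_not_mem_span _ _
    (hV.sub_notMem_span (hsub hu) (hsub hv) (hsub hw) huv hwu.symm hwv.symm)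
  obtain ⟨K, hK⟩ := exists_forall_lt_mul (V.filter (· ∉ τ)) (fun x => φ u - φ x)
    (fun x => c - l x) (by
      intro x hx
      rw [Finset.mem_filter] at hx
      exact sub_pos.2 (hl' x hx.1 hx.2))
  refine ⟨by simp [Finset.insert_subset_iff, hsub hu, hsub hv], K • l - φ, K * c - φ u, ?_, ?_⟩
  · intro x hx
    simp only [Finset.mem_insert, Finset.mem_singleton] at hx
    have : φ v = φ u := by simpa [sub_eq_zero] using hφ
    rcases hx with rfl | rfl
    · simp [hl _ hu]
    · simp [hl _ hv, this]
  · intro x hx hxn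
    simp only [LinearMap.sub_apply, LinearMap.smul_apply, smul_eq_mul]
    by_cases hxτ : x ∈ τ
    · have hxw : x = w := by
        rw [hτeq] at hxτ
        simp only [Finset.mem_insert, Finset.mem_singleton, not_or] at hxτ hxn
        tauto
      subst hxw
      rw [hl _ hw]
      rw [map_sub] at hφ'
      linarith
    · have := hK x (Finset.mem_filter.2 ⟨hx, hxτ⟩)
      linarith

/-- The level of `h` at `v` passes strictly between points of `τ`. -/
def Crosses (h : Module.Dual ℝ E3) (τ : Finset E3) (v : E3) : Prop :=
  (∃ w ∈ τ, h w < h v) ∧ ∃ w ∈ τ, h v < h w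

/-! ### Facets crossed by a plane through a vertex -/

theorem eq_triple_of_card {τ : Finset E3} (hcard : τ.card = 3) {u v w : E3} (hu : u ∈ τ)
    (hv : v ∈ τ) (hw : w ∈ τ) (huv : u ≠ v) (huw : u ≠ w) (hvw : v ≠ w) {x : E3} (hx : x ∈ τ) :
    x = u ∨ x = v ∨ x = w := by
  classical
  have : ({u, v, w} : Finset E3) = τ := by
    apply Finset.eq_of_subset_of_card_le
    · simp [Finset.insert_subset_iff, hu, hv, hw]
    · rw [hcard, Finset.card_eq_three.2 ⟨u, v, w, huv, huw, hvw, rfl⟩]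
  rw [← this] at hx
  simpa using hx

theorem exists_third {τ : Finset E3} (hcard : τ.card = 3) (u v : E3) :
    ∃ w ∈ τ, w ≠ u ∧ w ≠ v := by
  classical
  obtain ⟨w, hw, h⟩ := Finset.exists_mem_notMem_of_card_lt_card
    (show ({u, v} : Finset E3).card < τ.card by
      rw [hcard]; exact lt_of_le_of_lt Finset.card_le_two (by norm_num))
  simp only [Finset.mem_insert, Finset.mem_singleton, not_or] at h
  exact ⟨w, hw, h⟩

open Classical in
/-- The plane `h = h v` meets the cone at `v` in a planar cone with at most two boundary rays. Each
ray runs inside a crossed facet or along an edge. -/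
theorem SimplicialVertexSet.card_crosses_add_card_level_le_two {V : Finset E3}
    (hV : SimplicialVertexSet V) {v : E3} (hv : v ∈ V) {h : Module.Dual ℝ E3} (hh : h ≠ 0) :
    ((facets V).filter fun τ => v ∈ τ ∧ Crosses h τ v).card +
      (V.filter fun w => w ≠ v ∧ h w = h v ∧ ∃ τ ∈ facets V, v ∈ τ ∧ w ∈ τ).card ≤ 2 := by
  set X := (facets V).filter fun τ => v ∈ τ ∧ Crosses h τ v with hX
  set Z := V.filter fun w => w ≠ v ∧ h w = h v ∧ ∃ τ ∈ facets V, v ∈ τ ∧ w ∈ τ with hZ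
  have hXc : (X.image fun τ => τ.erase v).card = X.card := by
    apply Finset.card_image_of_injOn
    intro τ hτ σ hσ heq
    simp only [hX, Finset.coe_filter, Set.mem_ofPred_eq] at hτ hσ
    rw [← Finset.insert_erase hτ.2.1, ← Finset.insert_erase hσ.2.1]
    exact congrArg _ heq
  have hZc : (Z.image fun w => ({w} : Finset E3)).card = Z.card :=
    Finset.card_image_of_injective _ Finset.singleton_injective
  have hXcard : ∀ A ∈ X.image fun τ => τ.erase v, A.card = 2 := by
    intro A hA
    obtain ⟨τ, hτ, rfl⟩ := Finset.mem_image.1 hA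
    simp only [hX, Finset.mem_filter] at hτ
    rw [Finset.card_erase_of_mem hτ.2.1, (mem_facets.1 hτ.1).1]
  have hZcard : ∀ A ∈ Z.image fun w => ({w} : Finset E3), A.card = 1 := by
    intro A hA
    obtain ⟨w, hw, rfl⟩ := Finset.mem_image.1 hA
    simp
  have hXne : ∀ τ ∈ X, ∀ w ∈ τ, w ≠ v → h w ≠ h v := by
    intro τ hτ w hw hwv heq
    simp only [hX, Finset.mem_filter] at hτ
    obtain ⟨hτf, hvτ, ⟨p, hp, hpv⟩, q, hq, hqv⟩ := hτ
    have hpq : p ≠ q := fun e => by subst e; exact lt_asymm hpv hqv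
    rcases eq_triple_of_card (mem_facets.1 hτf).1 hvτ hp hq (fun e => hpv.ne (e ▸ rfl))
      (fun e => hqv.ne (e ▸ rfl)) hpq hw with e | e | e
    · exact hwv e
    · subst e; exact hpv.ne heq
    · subst e; exact hqv.ne heq.symm
  have hdisj : Disjoint (X.image fun τ => τ.erase v) (Z.image fun w => ({w} : Finset E3)) := by
    rw [Finset.disjoint_left]
    intro A hA hA'
    have := hXcard A hA
    have := hZcard A hA'
    omega
  rw [← hXc, ← hZc, ← Finset.card_union_of_disjoint hdisj]
  apply card_exposed_in_plane_le_two hV hv hh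
  · intro A hA B hB hAB
    rw [Finset.mem_union] at hA hB
    rcases hA with hA | hA <;> rcases hB with hB | hB
    · exact Finset.eq_of_subset_of_card_le hAB (by rw [hXcard A hA, hXcard B hB])
    · have := Finset.card_le_card hAB
      rw [hXcard A hA, hZcard B hB] at this
      omega
    · obtain ⟨w, hw, rfl⟩ := Finset.mem_image.1 hA
      obtain ⟨τ, hτ, rfl⟩ := Finset.mem_image.1 hB
      rw [Finset.singleton_subset_iff, Finset.mem_erase] at hAB
      simp only [hZ, Finset.mem_filter] at hw
      exact absurd hw.2.2.1 (hXne τ hτ w hAB.2 hAB.1)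
    · exact Finset.eq_of_subset_of_card_le hAB (by rw [hZcard A hA, hZcard B hB])
  · intro A hA
    rw [Finset.mem_union] at hA
    rcases hA with hA | hA
    · obtain ⟨τ, hτ, rfl⟩ := Finset.mem_image.1 hA
      have hne := hXne τ hτ
      simp only [hX, Finset.mem_filter] at hτ
      obtain ⟨hτf, hvτ, ⟨p, hp, hpv⟩, q, hq, hqv⟩ := hτ
      have hpq : p ≠ q := fun e => by subst e; exact lt_asymm hpv hqv
      have hvp : v ≠ p := fun e => hpv.ne (e ▸ rfl)
      have hvq : v ≠ q := fun e => hqv.ne (e ▸ rfl)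
      have he : τ.erase v = {p, q} := by
        ext x
        simp only [Finset.mem_erase, Finset.mem_insert, Finset.mem_singleton]
        constructor
        · rintro ⟨hxv, hx⟩
          have := eq_triple_of_card (mem_facets.1 hτf).1 hvτ hp hq hvp hvq hpq hx
          tauto
        · rintro (rfl | rfl)
          · exact ⟨hvp.symm, hp⟩
          · exact ⟨hvq.symm, hq⟩
      refine ⟨Finset.notMem_erase _ _, ⟨p, Finset.mem_erase.2 ⟨hvp.symm, hp⟩⟩, ?_, ?_⟩
      · rw [Finset.insert_erase hvτ]
        exact (mem_facets.1 hτf).2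
      · refine ⟨fun x => if x = p then h q - h v else h v - h p, ?_, ?_⟩
        · intro x _
          dsimp only
          split_ifs <;> linarith
        · rw [he, Finset.sum_pair hpq]
          simp only [if_true, if_neg hpq.symm, map_sub]
          ring
    · obtain ⟨w, hw, rfl⟩ := Finset.mem_image.1 hA
      simp only [hZ, Finset.mem_filter] at hw
      obtain ⟨hwV, hwv, hwl, τ, hτ, hvτ, hwτ⟩ := hw
      refine ⟨by simpa using hwv.symm, by simp, hV.isExposedSubset_pair hτ hvτ hwτ hwv.symm,
        fun _ => 1, by simp, by simp [hwl]⟩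

open Classical in
/-- An edge lies on at most two facets: modulo the edge, the facets through it become rays of a
planar cone. -/
theorem SimplicialVertexSet.card_facets_through_edge_le_two {V : Finset E3}
    (hV : SimplicialVertexSet V) {u v : E3} (huv : u ≠ v) :
    ((facets V).filter fun τ => u ∈ τ ∧ v ∈ τ).card ≤ 2 := by
  by_contra! hcard
  obtain ⟨A, hA, B, hB, C, hC, hAB, hAC, hBC⟩ := Finset.two_lt_card.1 hcard
  let S : Fin 3 → Finset E3 := ![A, B, C]
  have hS : ∀ i, S i ∈ facets V ∧ u ∈ S i ∧ v ∈ S i := by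
    intro i
    fin_cases i
    · exact Finset.mem_filter.1 hA
    · exact Finset.mem_filter.1 hB
    · exact Finset.mem_filter.1 hC
  have hne : ∀ i j, j ≠ i → S j ≠ S i := by
    intro i j hij
    fin_cases i <;> fin_cases j <;> simp_all [S, Ne.symm]
  choose hSf hSu hSv using hS
  choose x hx hxu hxv using fun i => exists_third (mem_facets.1 (hSf i)).1 u v
  choose hcard3 hsub l k hl hl' using fun i => mem_facets.1 (hSf i)
  have hxn : ∀ i j, j ≠ i → x j ∉ S i := by
    intro i j hij hmem
    apply hne i j hij
    apply Finset.eq_of_subset_of_card_le _ (by rw [hcard3, hcard3])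
    intro y hy
    rcases eq_triple_of_card (hcard3 j) (hSu j) (hSv j) (hx j) huv (hxu j).symm (hxv j).symm hy
      with rfl | rfl | rfl
    · exact hSu i
    · exact hSv i
    · exact hmem
  obtain ⟨-, e, c, he, he'⟩ := hV.isExposedSubset_pair (hSf 0) (hSu 0) (hSv 0) huv
  have heu := he u (by simp)
  have hev := he v (by simp)
  obtain ⟨φ, hφ⟩ : ∃ φ : Module.Dual ℝ E3, φ (v - u) = 1 := by
    obtain ⟨φ, -, hφ⟩ := exists_dual_of_not_mem_span 0 (v - u)
      (by simpa [sub_eq_zero] using huv.symm)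
    exact ⟨φ, hφ⟩
  have hφ0 : φ ≠ 0 := by
    rintro rfl
    simp at hφ
  refine false_of_three_exposed_in_plane hφ0 (g := -e)
    (fun i => (x i - u) - φ (x i - u) • (v - u)) ?_ ?_ l ?_ ?_
  · intro i
    rw [map_sub, map_smul, hφ]
    simp
  · intro i
    have h1 := he' (x i) (hsub i (hx i)) (by simp [hxu i, hxv i])
    simp only [map_sub, map_smul, LinearMap.neg_apply, heu, hev, smul_eq_mul]
    linarith
  · intro i
    simp only [map_sub, map_smul, smul_eq_mul, hl i _ (hSu i), hl i _ (hSv i), hl i _ (hx i)]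
    ring
  · intro i j hij
    simp only [map_sub, map_smul, smul_eq_mul, hl i _ (hSu i), hl i _ (hSv i)]
    have := hl' i (x j) (hsub j (hx j)) (hxn i j hij)
    linarith

open Classical in
/-- If `v` is not extreme for `h`, then some facet at `v` is crossed by the level of `h`. It is
found by tilting the plane `k = k v` as far as possible, `g` being minimal at `v` only. -/
theorem SimplicialVertexSet.exists_crossed_facet {V : Finset E3} (hV : SimplicialVertexSet V)
    {v : E3} (hv : v ∈ V) {h g k : Module.Dual ℝ E3} (hinj : Set.InjOn h V)
    (hg : ∀ w ∈ V, w ≠ v → g v < g w) (hlow : ∃ w ∈ V, h w < h v) (hhigh : ∃ w ∈ V, h v < h w)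
    {z : E3} (hgz : g z = 0) (hhz : h z = 0) (hkz : k z ≠ 0) :
    ∃ τ ∈ facets V, v ∈ τ ∧ Crosses h τ v ∧ ∃ l : Module.Dual ℝ E3, l z = k z ∧
      (∀ x ∈ τ, l x = l v) ∧ ∀ x ∈ V, x ∉ τ → l x < l v := by
  obtain ⟨p₁, hp₁, hp₁h⟩ := hhigh
  obtain ⟨q₁, hq₁, hq₁h⟩ := hlow
  set U := (V.filter fun p => h v < h p) ×ˢ (V.filter fun q => h q < h v) with hU
  have hUne : U.Nonempty := ⟨(p₁, q₁), by simp [hU, hp₁, hq₁, hp₁h, hq₁h]⟩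
  -- the value of `m` at the point of the segment from `p` to `q` on the level of `v`, rescaled
  let val : Module.Dual ℝ E3 → E3 × E3 → ℝ := fun m r =>
    (h v - h r.2) * (m r.1 - m v) + (h r.1 - h v) * (m r.2 - m v)
  have hgpos : ∀ r ∈ U, 0 < val g r := by
    rintro ⟨p, q⟩ hr
    simp only [hU, Finset.mem_product, Finset.mem_filter] at hr
    obtain ⟨⟨hp, hpv⟩, hq, hqv⟩ := hr
    have h1 := hg p hp (fun e => hpv.ne (e ▸ rfl))
    have h2 := hg q hq (fun e => hqv.ne (e ▸ rfl))
    have := mul_pos (sub_pos.2 hqv) (sub_pos.2 h1)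
    have := mul_pos (sub_pos.2 hpv) (sub_pos.2 h2)
    simp only [val]
    linarith
  obtain ⟨⟨p, q⟩, hr, hmax⟩ := Finset.exists_max_image U (fun r => val k r / val g r) hUne
  have hg0 := hgpos _ hr
  set s := val k (p, q) / val g (p, q) with hs
  set m : Module.Dual ℝ E3 := k - s • g with hm
  have hmle : ∀ r ∈ U, val m r ≤ 0 := by
    intro r hrU
    have h1 := hmax r hrU
    rw [div_le_iff₀ (hgpos r hrU)] at h1
    have : val m r = val k r - s * val g r := by
      simp only [val, hm, LinearMap.sub_apply, LinearMap.smul_apply, smul_eq_mul]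
      ring
    linarith
  have hmeq : val m (p, q) = 0 := by
    have : val m (p, q) = val k (p, q) - s * val g (p, q) := by
      simp only [val, hm, LinearMap.sub_apply, LinearMap.smul_apply, smul_eq_mul]
      ring
    rw [this, hs, div_mul_cancel₀ _ hg0.ne', sub_self]
  simp only [hU, Finset.mem_product, Finset.mem_filter] at hr
  obtain ⟨⟨hp, hpv⟩, hq, hqv⟩ := hr
  have hP : 0 < h p - h v := sub_pos.2 hpv
  have hQ : 0 < h v - h q := sub_pos.2 hqv
  set t := (m q - m v) / (h v - h q) with ht
  have htq : t * (h v - h q) = m q - m v := div_mul_cancel₀ _ hQ.ne'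
  have htp : t * (h p - h v) = -(m p - m v) := by
    have : (h v - h q) * (t * (h p - h v) + (m p - m v)) = 0 := by
      have h2 := hmeq
      simp only [val] at h2
      linear_combination h2 + (h p - h v) * htq
    rcases mul_eq_zero.1 this with h3 | h3
    · exact absurd h3 hQ.ne'
    · linarith
  set l : Module.Dual ℝ E3 := m + t • h with hl
  have hlv : ∀ x, l x - l v = (m x - m v) + t * (h x - h v) := by
    intro x
    simp only [hl, LinearMap.add_apply, LinearMap.smul_apply, smul_eq_mul]
    ring
  have hlz : l z = k z := by
    simp [hl, hm, hgz, hhz]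
  have hle : ∀ x ∈ V, l x ≤ l v := by
    intro x hx
    rcases lt_trichotomy (h x) (h v) with hlt | heq | hgt
    · have h1 := hmle (p, x) (by simp [hU, hp, hpv, hx, hlt])
      simp only [val] at h1
      have : (h p - h v) * (l x - l v) ≤ 0 := by
        rw [hlv]
        linear_combination h1 + (h x - h v) * htp
      nlinarith
    · rw [hinj hx hv heq]
    · have h1 := hmle (x, q) (by simp [hU, hq, hqv, hx, hgt])
      simp only [val] at h1
      have : (h v - h q) * (l x - l v) ≤ 0 := by
        rw [hlv]
        linear_combination h1 + (h x - h v) * htq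
      nlinarith
  have hlp : l p = l v := by
    have := hlv p
    linarith
  have hlq : l q = l v := by
    have := hlv q
    linarith
  have hl0 : l ≠ 0 := by
    intro h0
    rw [h0] at hlz
    exact hkz (by simpa using hlz.symm)
  have hpv' : v ≠ p := fun e => hpv.ne (e ▸ rfl)
  have hqv' : v ≠ q := fun e => hqv.ne (e ▸ rfl)
  have hpq : p ≠ q := fun e => by subst e; exact lt_asymm hpv hqv
  set τ := V.filter fun x => l x = l v with hτ
  have hcard : τ.card = 3 := by
    apply le_antisymm (hV.card_le_three l hl0 _ hle)
    refine (Finset.card_eq_three.2 ⟨v, p, q, hpv', hqv', hpq, rfl⟩).symm.le.trans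
      (Finset.card_le_card ?_)
    simp [Finset.insert_subset_iff, hv, hp, hq, hlp, hlq]
  have hτin : ∀ x ∈ τ, l x = l v := fun x hx => (Finset.mem_filter.1 hx).2
  have hτout : ∀ x ∈ V, x ∉ τ → l x < l v := fun x hx hxn =>
    lt_of_le_of_ne (hle x hx) fun h => hxn (Finset.mem_filter.2 ⟨hx, h⟩)
  refine ⟨τ, mem_facets.2 ⟨hcard, Finset.filter_subset _ _, l, l v, hτin, hτout⟩,
    by simp [hτ, hv], ⟨⟨q, by simp [hτ, hq, hlq], hqv⟩, p, by simp [hτ, hp, hlp], hpv⟩,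
    l, hlz, hτin, hτout⟩

open Classical in
/-- Tilting in opposite directions, `k` and `-k`, gives two different crossed facets. -/
theorem SimplicialVertexSet.two_le_card_crosses {V : Finset E3} (hV : SimplicialVertexSet V)
    {v : E3} (hv : v ∈ V) {h : Module.Dual ℝ E3} (hinj : Set.InjOn h V)
    (hlow : ∃ w ∈ V, h w < h v) (hhigh : ∃ w ∈ V, h v < h w) :
    2 ≤ ((facets V).filter fun τ => v ∈ τ ∧ Crosses h τ v).card := by
  obtain ⟨g, hg⟩ := hV.exposed v hv
  obtain ⟨z, hz, hz0⟩ : ∃ z ∈ LinearMap.ker (h.prod g), z ≠ 0 := by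
    apply Submodule.exists_mem_ne_zero_of_ne_bot
    apply LinearMap.ker_ne_bot_of_finrank_lt
    simp
  have hhz : h z = 0 ∧ g z = 0 := by simpa using hz
  obtain ⟨k, -, hk⟩ := exists_dual_of_not_mem_span 0 z (by simpa using hz0)
  obtain ⟨τ, hτ, hvτ, hτc, l, hlz, hl, hl'⟩ := hV.exists_crossed_facet hv (k := k) hinj hg hlow
    hhigh hhz.2 hhz.1 (by simp [hk])
  obtain ⟨σ, hσ, hvσ, hσc, m, hmz, hm, hm'⟩ := hV.exists_crossed_facet hv (k := -k) hinj hg hlow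
    hhigh hhz.2 hhz.1 (by simp [hk])
  have hne : τ ≠ σ := by
    rintro rfl
    obtain ⟨⟨q, hq, hqv⟩, p, hp, hpv⟩ := hτc
    have hsub := (mem_facets.1 hτ).2.1
    have hl0 : l ≠ 0 := by
      rintro rfl
      simp [hk] at hlz
    obtain ⟨x, hx, hxl⟩ := hV.exists_ne l hl0 (l v)
    have hxτ : x ∉ τ := fun hmem => hxl (hl x hmem)
    have h1 := hl' x hx hxτ
    have h2 := hm' x hx hxτ
    -- `f` vanishes on the directions of the facet and towards `x`, but not at `z`
    set f : Module.Dual ℝ E3 := (m v - m x) • l - (l v - l x) • m with hf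
    have hfz : f z ≠ 0 := by
      simp only [hf, LinearMap.sub_apply, LinearMap.smul_apply, hlz, hmz, LinearMap.neg_apply, hk,
        smul_eq_mul]
      nlinarith
    have hf0 : f ≠ 0 := fun e => hfz (by simp [e])
    have hfx : ∀ y, f (y - v) = (m v - m x) * (l y - l v) - (l v - l x) * (m y - m v) := by
      intro y
      simp only [hf, LinearMap.sub_apply, LinearMap.smul_apply, map_sub, smul_eq_mul]
      ring
    obtain ⟨c, hc, hrel⟩ := exists_relation_of_mem_ker hf0 ![p - v, q - v, x - v] (by
      intro i
      fin_cases i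
      · simp [-map_sub, hfx, hl p hp, hm p hp]
      · simp [-map_sub, hfx, hl q hq, hm q hq]
      · simp [-map_sub, hfx]
        ring)
    have key : ∀ r : Module.Dual ℝ E3, c 0 * (r p - r v) + c 1 * (r q - r v)
        + c 2 * (r x - r v) = 0 := by
      intro r
      have := congrArg r hrel
      simpa [Fin.sum_univ_three] using this
    have hc2 : c 2 = 0 := by
      have := key l
      rw [hl p hp, hl q hq] at this
      simp only [sub_self, mul_zero, zero_add] at this
      rcases mul_eq_zero.1 this with h | h
      · exact h
      · linarith
    have e1 := key h
    have e2 := key g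
    rw [hc2] at e1 e2
    have g1 := hg p (hsub hp) (fun e => hpv.ne (e ▸ rfl))
    have g2 := hg q (hsub hq) (fun e => hqv.ne (e ▸ rfl))
    have hdet : 0 < (h p - h v) * (g q - g v) + (h v - h q) * (g p - g v) :=
      add_pos (mul_pos (sub_pos.2 hpv) (sub_pos.2 g2)) (mul_pos (sub_pos.2 hqv) (sub_pos.2 g1))
    have hc0 : c 0 = 0 := by
      have : c 0 * ((h p - h v) * (g q - g v) + (h v - h q) * (g p - g v)) = 0 := by
        linear_combination (g q - g v) * e1 - (h q - h v) * e2
      exact (mul_eq_zero.1 this).resolve_right hdet.ne'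
    have hc1 : c 1 = 0 := by
      have : c 1 * ((h p - h v) * (g q - g v) + (h v - h q) * (g p - g v)) = 0 := by
        linear_combination (h p - h v) * e2 - (g p - g v) * e1
      exact (mul_eq_zero.1 this).resolve_right hdet.ne'
    apply hc
    funext i
    fin_cases i <;> assumption
  rw [← Finset.card_pair hne]
  apply Finset.card_le_card
  intro ρ hρ
  simp only [Finset.mem_insert, Finset.mem_singleton] at hρ
  rcases hρ with rfl | rfl
  · exact Finset.mem_filter.2 ⟨hτ, hvτ, hτc⟩
  · exact Finset.mem_filter.2 ⟨hσ, hvσ, hσc⟩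

/-! ### Counting facets by middle vertices -/

/-- Every linear functional can be perturbed to one that is injective on a finite set and keeps its
strict inequalities there. -/
theorem exists_injOn_perturbation (V : Finset E3) (f : Module.Dual ℝ E3) :
    ∃ h : Module.Dual ℝ E3, Set.InjOn h V ∧ ∀ u ∈ V, ∀ v ∈ V, f u < f v → h u < h v := by
  classical
  obtain ⟨k, hk⟩ := Module.exists_dual_forall_apply_ne_zero (K := ℝ)
    (fun i : {p : V × V // p.1 ≠ p.2} => ((i.1.1 : E3) - i.1.2))
    (fun i => sub_ne_zero.2 fun e => i.2 (Subtype.ext e))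
  have hk' : ∀ u ∈ V, ∀ v ∈ V, u ≠ v → k u - k v ≠ 0 := by
    intro u hu v hv huv
    have := hk ⟨(⟨u, hu⟩, ⟨v, hv⟩), fun e => huv (congrArg Subtype.val e)⟩
    simpa using this
  have ev : ∀ᶠ ε : ℝ in nhdsWithin 0 (Set.Ioi 0), ∀ u ∈ V, ∀ v ∈ V,
      (u ≠ v → f u + ε * k u ≠ f v + ε * k v) ∧ (f u < f v → f u + ε * k u < f v + ε * k v) := by
    rw [Filter.eventually_all_finset]
    intro u hu
    rw [Filter.eventually_all_finset]
    intro v hv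
    have lt : ∀ u v : E3, f u < f v →
        ∀ᶠ ε : ℝ in nhdsWithin 0 (Set.Ioi 0), f u + ε * k u < f v + ε * k v := by
      intro u v huv
      apply nhdsWithin_le_nhds
      have hc : Continuous fun ε : ℝ => (f v + ε * k v) - (f u + ε * k u) := by fun_prop
      have := hc.continuousAt.eventually_mem (x := 0) (Ioi_mem_nhds (a := 0) (by simpa using huv))
      filter_upwards [this] with ε hε
      have : 0 < (f v + ε * k v) - (f u + ε * k u) := hε
      linarith
    rcases lt_trichotomy (f u) (f v) with h | h | h
    · filter_upwards [lt u v h] with ε hε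
      exact ⟨fun _ => hε.ne, fun _ => hε⟩
    · filter_upwards [self_mem_nhdsWithin] with ε hε
      refine ⟨fun huv e => ?_, fun h' => absurd h h'.ne⟩
      have h0 : ε * (k u - k v) = 0 := by linarith
      exact (mul_ne_zero (ne_of_gt hε) (hk' u hu v hv huv)) h0
    · filter_upwards [lt v u h] with ε hε
      exact ⟨fun _ => hε.ne', fun h' => absurd h' h.not_gt⟩
  obtain ⟨ε, hε⟩ := ev.exists
  refine ⟨f + ε • k, ?_, ?_⟩
  · intro u hu v hv huv
    by_contra hne
    exact (hε u hu v hv).1 hne (by simpa using huv)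
  · intro u hu v hv huv
    simpa using (hε u hu v hv).2 huv

open Classical in
/-- A triangle on which `h` is injective has exactly one middle vertex. -/
theorem card_filter_crosses_eq_one {τ : Finset E3} (hcard : τ.card = 3) {h : Module.Dual ℝ E3}
    (hinj : Set.InjOn h τ) : (τ.filter fun v => Crosses h τ v).card = 1 := by
  have hne : τ.Nonempty := Finset.card_pos.1 (by omega)
  obtain ⟨p, hp, hpmin⟩ := Finset.exists_min_image τ h hne
  obtain ⟨q, hq, hqmax⟩ := Finset.exists_max_image τ h hne
  obtain ⟨w, hw, hwp, hwq⟩ := exists_third hcard p q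
  have h1 : h p < h w := lt_of_le_of_ne (hpmin w hw) fun e => hwp (hinj hp hw e).symm
  have h2 : h w < h q := lt_of_le_of_ne (hqmax w hw) fun e => hwq (hinj hw hq e)
  have hpq : p ≠ q := fun e => by subst e; exact lt_asymm h1 h2
  rw [Finset.card_eq_one]
  refine ⟨w, Finset.ext fun x => ?_⟩
  simp only [Finset.mem_filter, Finset.mem_singleton]
  constructor
  · rintro ⟨hx, ⟨y, hy, hyx⟩, z, hz, hxz⟩
    rcases eq_triple_of_card hcard hp hq hw hpq hwp.symm hwq.symm hx with rfl | rfl | rfl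
    · exact absurd (hpmin y hy) hyx.not_ge
    · exact absurd (hqmax z hz) hxz.not_ge
    · rfl
  · rintro rfl
    exact ⟨hw, ⟨p, hp, h1⟩, q, hq, h2⟩

open Classical in
/-- Facets are counted by their middle vertices. -/
theorem card_eq_sum_card_crosses {V : Finset E3} {h : Module.Dual ℝ E3} (hinj : Set.InjOn h V)
    {𝓢 : Finset (Finset E3)} (h𝓢 : 𝓢 ⊆ facets V) :
    𝓢.card = ∑ v ∈ V, (𝓢.filter fun τ => v ∈ τ ∧ Crosses h τ v).card := by
  have := Finset.sum_card_bipartiteAbove_eq_sum_card_bipartiteBelow (s := V) (t := 𝓢)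
    (fun v τ => v ∈ τ ∧ Crosses h τ v)
  simp only [Finset.bipartiteAbove, Finset.bipartiteBelow] at this
  rw [this, Finset.card_eq_sum_ones]
  refine Finset.sum_congr rfl fun τ hτ => ?_
  obtain ⟨hcard, hsub, -⟩ := mem_facets.1 (h𝓢 hτ)
  rw [← card_filter_crosses_eq_one hcard (hinj.mono hsub)]
  congr 1
  ext x
  simp only [Finset.mem_filter]
  exact ⟨fun hx => ⟨hsub hx.1, hx⟩, fun hx => hx.2⟩

open Classical in
/-- The points of `S` at which `h` attains neither its minimum nor its maximum over `S`. -/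
noncomputable def nonextreme (h : Module.Dual ℝ E3) (S : Finset E3) : Finset E3 :=
  S.filter fun v => Crosses h S v

theorem card_le_card_nonextreme_add_two (h : Module.Dual ℝ E3) {S : Finset E3}
    (hinj : Set.InjOn h S) : S.card ≤ (nonextreme h S).card + 2 := by
  classical
  rcases S.eq_empty_or_nonempty with rfl | hne
  · simp
  obtain ⟨p, hp, hpmin⟩ := Finset.exists_min_image S h hne
  obtain ⟨q, hq, hqmax⟩ := Finset.exists_max_image S h hne
  have : S ⊆ nonextreme h S ∪ {p, q} := by
    intro x hx
    by_cases hxp : x = p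
    · simp [hxp]
    by_cases hxq : x = q
    · simp [hxq]
    refine Finset.mem_union_left _ (Finset.mem_filter.2 ⟨hx, ⟨p, hp, ?_⟩, q, hq, ?_⟩)
    · exact lt_of_le_of_ne (hpmin x hx) fun e => hxp (hinj hp hx e).symm
    · exact lt_of_le_of_ne (hqmax x hx) fun e => hxq (hinj hx hq e)
  have h1 := Finset.card_le_card this
  have h2 := Finset.card_union_le (nonextreme h S) {p, q}
  have h3 : ({p, q} : Finset E3).card ≤ 2 := Finset.card_le_two
  omega

theorem card_nonextreme_add_one_le (h : Module.Dual ℝ E3) {S : Finset E3} (hne : S.Nonempty) :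
    (nonextreme h S).card + 1 ≤ S.card := by
  classical
  obtain ⟨p, hp, hpmin⟩ := Finset.exists_min_image S h hne
  have : nonextreme h S ⊆ S.erase p := by
    intro x hx
    obtain ⟨hx, ⟨y, hy, hyx⟩, -⟩ := Finset.mem_filter.1 hx
    refine Finset.mem_erase.2 ⟨?_, hx⟩
    rintro rfl
    exact absurd (hpmin y hy) hyx.not_ge
  have h1 := Finset.card_le_card this
  have h2 := Finset.card_erase_add_one hp
  omega

theorem card_nonextreme_add_two_le (h : Module.Dual ℝ E3) {S : Finset E3}
    (hinj : Set.InjOn h S) (hS : 2 ≤ S.card) : (nonextreme h S).card + 2 ≤ S.card := by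
  classical
  have hne : S.Nonempty := Finset.card_pos.1 (by omega)
  obtain ⟨p, hp, hpmin⟩ := Finset.exists_min_image S h hne
  obtain ⟨q, hq, hqmax⟩ := Finset.exists_max_image S h hne
  have hpq : p ≠ q := by
    rintro rfl
    obtain ⟨x, hx, hxp⟩ := Finset.exists_mem_ne (by omega : 1 < S.card) p
    exact hxp (hinj hx hp (le_antisymm (hqmax x hx) (hpmin x hx)))
  have : nonextreme h S ⊆ (S.erase p).erase q := by
    intro x hx
    obtain ⟨hx, ⟨y, hy, hyx⟩, z, hz, hxz⟩ := Finset.mem_filter.1 hx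
    refine Finset.mem_erase.2 ⟨?_, Finset.mem_erase.2 ⟨?_, hx⟩⟩
    · rintro rfl
      exact absurd (hqmax z hz) hxz.not_ge
    · rintro rfl
      exact absurd (hpmin y hy) hyx.not_ge
  have h1 := Finset.card_le_card this
  have h2 := Finset.card_erase_add_one hp
  have h3 := Finset.card_erase_add_one (Finset.mem_erase.2 ⟨hpq.symm, hq⟩ : q ∈ S.erase p)
  omega

open Classical in
/-- The lower bound in Euler's formula: there are at least `2 n - 4` facets. -/
theorem SimplicialVertexSet.two_mul_card_le {V : Finset E3} (hV : SimplicialVertexSet V) :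
    2 * V.card ≤ (facets V).card + 4 := by
  obtain ⟨h, hinj, -⟩ := exists_injOn_perturbation V 0
  have h1 : 2 * (nonextreme h V).card ≤ (facets V).card := by
    rw [card_eq_sum_card_crosses hinj (Finset.Subset.refl _)]
    calc 2 * (nonextreme h V).card = ∑ v ∈ nonextreme h V, 2 := by simp [mul_comm]
      _ ≤ ∑ v ∈ nonextreme h V, ((facets V).filter fun τ => v ∈ τ ∧ Crosses h τ v).card := by
          refine Finset.sum_le_sum fun v hv => ?_
          obtain ⟨hv, hlow, hhigh⟩ := Finset.mem_filter.1 hv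
          exact hV.two_le_card_crosses hv hinj hlow hhigh
      _ ≤ _ := Finset.sum_le_sum_of_subset (Finset.filter_subset _ _)
  have h2 := card_le_card_nonextreme_add_two h hinj
  omega

open Classical in
/-- Facets inside `S` are counted by their middle vertices, which are not extreme in `S` and each
serve at most two facets. -/
theorem SimplicialVertexSet.card_facets_subset_le {V : Finset E3} (hV : SimplicialVertexSet V)
    {h : Module.Dual ℝ E3} (hinj : Set.InjOn h V) {S : Finset E3} (hS : S ⊆ V) :
    ((facets V).filter fun τ => τ ⊆ S).card ≤ 2 * (nonextreme h S).card ∧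
      ∀ d ∈ nonextreme h S, (∃ τ ∈ facets V, ¬ τ ⊆ S ∧ d ∈ τ ∧ Crosses h τ d) →
        ((facets V).filter fun τ => τ ⊆ S).card + 1 ≤ 2 * (nonextreme h S).card := by
  set 𝓢 := (facets V).filter fun τ => τ ⊆ S with h𝓢
  set N : E3 → ℕ := fun v => (𝓢.filter fun τ => v ∈ τ ∧ Crosses h τ v).card with hN
  have hsum : 𝓢.card = ∑ v ∈ nonextreme h S, N v := by
    rw [card_eq_sum_card_crosses hinj (Finset.filter_subset _ _)]
    symm
    refine Finset.sum_subset ((Finset.filter_subset _ _).trans hS) fun v _ hvn => ?_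
    rw [Finset.card_eq_zero, Finset.filter_eq_empty_iff]
    rintro τ hτ ⟨hvτ, ⟨p, hp, hpv⟩, q, hq, hqv⟩
    have hsub := (Finset.mem_filter.1 hτ).2
    exact hvn (Finset.mem_filter.2 ⟨hsub hvτ, ⟨p, hsub hp, hpv⟩, q, hsub hq, hqv⟩)
  have htwo : ∀ v ∈ nonextreme h S,
      ((facets V).filter fun τ => v ∈ τ ∧ Crosses h τ v).card ≤ 2 := by
    intro v hv
    obtain ⟨hvS, ⟨p, hp, hpv⟩, -⟩ := Finset.mem_filter.1 hv
    have h0 : h ≠ 0 := by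
      rintro rfl
      simp at hpv
    have := hV.card_crosses_add_card_level_le_two (hS hvS) h0
    omega
  have hNle : ∀ v ∈ nonextreme h S, N v ≤ 2 := fun v hv =>
    (Finset.card_le_card (Finset.filter_subset_filter _ (Finset.filter_subset _ _))).trans
      (htwo v hv)
  have hconst : ∑ v ∈ nonextreme h S, 2 = 2 * (nonextreme h S).card := by simp [mul_comm]
  constructor
  · rw [hsum, ← hconst]
    exact Finset.sum_le_sum hNle
  · rintro d hd ⟨τ, hτ, hτS, hdτ, hcr⟩
    rw [hsum, ← hconst]
    refine Nat.succ_le_of_lt (Finset.sum_lt_sum hNle ⟨d, hd, ?_⟩)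
    refine lt_of_lt_of_le (Finset.card_lt_card ?_) (htwo d hd)
    refine Finset.ssubset_iff_of_subset (Finset.filter_subset_filter _ (Finset.filter_subset _ _))
      |>.2 ⟨τ, Finset.mem_filter.2 ⟨hτ, hdτ, hcr⟩, fun hmem => ?_⟩
    exact hτS (Finset.mem_filter.1 (Finset.mem_filter.1 hmem).1).2

open Classical in
/-- A facet joins every proper subset of `V` with at least two points to its complement; otherwise
there would be too few facets. -/
theorem SimplicialVertexSet.exists_mixed_facet {V : Finset E3} (hV : SimplicialVertexSet V)
    {D : Finset E3} (hD : D ⊆ V) (hcard : 2 ≤ D.card) (hne : D ≠ V) :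
    ∃ τ ∈ facets V, (∃ d ∈ τ, d ∈ D) ∧ ∃ l ∈ τ, l ∉ D := by
  by_contra! hcon
  obtain ⟨h, hinj, -⟩ := exists_injOn_perturbation V 0
  have hsdiff : (V \ D).Nonempty := by
    rw [Finset.sdiff_nonempty]
    exact fun hsub => hne (hD.antisymm hsub)
  have h1 := (hV.card_facets_subset_le hinj hD).1
  have h2 := (hV.card_facets_subset_le hinj (Finset.sdiff_subset : V \ D ⊆ V)).1
  have h3 := card_nonextreme_add_two_le h (hinj.mono hD) hcard
  have h4 := card_nonextreme_add_one_le h hsdiff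
  have h5 := hV.two_mul_card_le
  have h6 : facets V ⊆ ((facets V).filter fun τ => τ ⊆ D) ∪
      (facets V).filter fun τ => τ ⊆ V \ D := by
    intro τ hτ
    rw [Finset.mem_union, Finset.mem_filter, Finset.mem_filter]
    by_cases hd : ∃ d ∈ τ, d ∈ D
    · exact Or.inl ⟨hτ, fun l hl => hcon τ hτ hd l hl⟩
    · push Not at hd
      exact Or.inr ⟨hτ, fun l hl => Finset.mem_sdiff.2 ⟨(mem_facets.1 hτ).2.1 hl, hd l hl⟩⟩
  have h7 := (Finset.card_le_card h6).trans (Finset.card_union_le _ _)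
  have h8 := Finset.card_sdiff_add_card_eq_card hD
  omega

/-- A vertex `d` of a facet, with at least two further points of `D ∋ d` available, is the middle of
the facet and nonextreme in `D` for a suitable functional: rotate a plane through `d` that separates
the other two vertices of the facet until it separates points of `D` as well. -/
theorem SimplicialVertexSet.exists_crosses_nonextreme {V : Finset E3}
    (hV : SimplicialVertexSet V) {D : Finset E3} (hD : D ⊆ V) (hcard : 3 ≤ D.card)
    {τ : Finset E3} (hτ : τ ∈ facets V) {d l : E3} (hd : d ∈ τ) (hdD : d ∈ D) (hl : l ∈ τ)
    (hlD : l ∉ D) : ∃ h : Module.Dual ℝ E3, Set.InjOn h V ∧ Crosses h τ d ∧ d ∈ nonextreme h D := by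
  classical
  suffices ∃ f : Module.Dual ℝ E3, Crosses f τ d ∧ Crosses f D d by
    obtain ⟨f, hfτ, hfD⟩ := this
    obtain ⟨h, hinj, hh⟩ := exists_injOn_perturbation V f
    have trans : ∀ S ⊆ V, Crosses f S d → Crosses h S d := by
      rintro S hS ⟨⟨p, hp, hpd⟩, q, hq, hqd⟩
      exact ⟨⟨p, hp, hh _ (hS hp) _ (hD hdD) hpd⟩, q, hq, hh _ (hD hdD) _ (hS hq) hqd⟩
    exact ⟨h, hinj, trans τ (mem_facets.1 hτ).2.1 hfτ,
      Finset.mem_filter.2 ⟨hdD, trans D hD hfD⟩⟩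
  obtain ⟨hcard3, hsub, m, c, hm, hm'⟩ := mem_facets.1 hτ
  have hdl : d ≠ l := fun e => hlD (e ▸ hdD)
  obtain ⟨x, hx, hxd, hxl⟩ := exists_third hcard3 d l
  obtain ⟨ψ₂, hψ₂l, hψ₂x⟩ := exists_dual_of_not_mem_span _ _
    (hV.sub_notMem_span (hsub hd) (hsub hl) (hsub hx) hdl hxd.symm hxl.symm)
  obtain ⟨ψ₁, hψ₁x, hψ₁l⟩ := exists_dual_of_not_mem_span _ _
    (hV.sub_notMem_span (hsub hd) (hsub hx) (hsub hl) hxd.symm hdl hxl)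
  rw [map_sub] at hψ₂l hψ₂x hψ₁x hψ₁l
  have hmd := hm d hd
  have hml := hm l hl
  have hmx := hm x hx
  by_cases hxD : x ∈ D
  · obtain ⟨y, hy, hyd, hyx⟩ : ∃ y ∈ D, y ≠ d ∧ y ≠ x := by
      obtain ⟨y, hy, h⟩ := Finset.exists_mem_notMem_of_card_lt_card
        (show ({d, x} : Finset E3).card < D.card from
          lt_of_le_of_lt Finset.card_le_two (by omega))
      simp only [Finset.mem_insert, Finset.mem_singleton, not_or] at h
      exact ⟨y, hy, h⟩
    have hyτ : y ∉ τ := by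
      intro hmem
      rcases eq_triple_of_card hcard3 hd hl hx hdl hxd.symm hxl.symm hmem with e | e | e
      · exact hyd e
      · exact hlD (e ▸ hy)
      · exact hyx e
    have hmy := hm' y (hD hy) hyτ
    obtain ⟨K, hK⟩ := exists_forall_lt_mul {y} (fun y => (ψ₁ d - ψ₂ d) - (ψ₁ y - ψ₂ y))
      (fun y => c - m y) (by simpa using hmy)
    have hKy := hK y (Finset.mem_singleton_self y)
    refine ⟨ψ₁ - ψ₂ - K • m, ⟨⟨x, hx, ?_⟩, l, hl, ?_⟩, ⟨x, hxD, ?_⟩, y, hy, ?_⟩ <;>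
    · simp only [LinearMap.sub_apply, LinearMap.smul_apply, smul_eq_mul, hmx, hmd, hml]
      linarith
  · have : 1 < (D.erase d).card := by
      rw [Finset.card_erase_of_mem hdD]
      omega
    obtain ⟨y, hy, z, hz, hyz⟩ := Finset.one_lt_card.1 this
    rw [Finset.mem_erase] at hy hz
    have notMem : ∀ y ∈ D, y ≠ d → y ∉ τ := by
      intro y hy hyd hmem
      rcases eq_triple_of_card hcard3 hd hl hx hdl hxd.symm hxl.symm hmem with e | e | e
      · exact hyd e
      · exact hlD (e ▸ hy)
      · exact hxD (e ▸ hy)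
    have hmy := hm' y (hD hy.2) (notMem y hy.2 hy.1)
    have hmz := hm' z (hD hz.2) (notMem z hz.2 hz.1)
    set p : E3 := (c - m z) • (y - d) - (c - m y) • (z - d) with hp
    have hp0 : p ≠ 0 := by
      intro h0
      apply hV.sub_notMem_span (hsub hd) (hD hy.2) (hD hz.2) hy.1.symm hz.1.symm hyz
      rw [Submodule.mem_span_singleton]
      refine ⟨(c - m y)⁻¹ * (c - m z), ?_⟩
      rw [mul_smul, sub_eq_zero.1 (hp.symm.trans h0), smul_smul,
        inv_mul_cancel₀ (sub_pos.2 hmy).ne', one_smul]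
    have hmp : m p = 0 := by
      simp only [hp, map_sub, map_smul, smul_eq_mul, hmd]
      ring
    have hψp : ψ₁ p ≠ 0 ∨ ψ₂ p ≠ 0 := by
      by_contra! h
      have hm0 : m ≠ 0 := by
        rintro rfl
        simp only [LinearMap.zero_apply] at hmy hmd
        linarith
      obtain ⟨e, he, hrel⟩ := exists_relation_of_mem_ker hm0 ![l - d, x - d, p] (by
        intro i
        fin_cases i <;> simp [hmp, hml, hmd, hmx])
      have key : ∀ r : Module.Dual ℝ E3, e 0 * (r l - r d) + e 1 * (r x - r d) + e 2 * r p = 0 := by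
        intro r
        have := congrArg r hrel
        simpa [Fin.sum_univ_three] using this
      have e0 : e 0 = 0 := by
        have := key ψ₁
        rw [hψ₁l, hψ₁x, h.1] at this
        linarith
      have e1 : e 1 = 0 := by
        have := key ψ₂
        rw [hψ₂l, hψ₂x, h.2] at this
        linarith
      have e2 : e 2 = 0 := by
        have h1 : e 2 • p = 0 := by simpa [Fin.sum_univ_three, e0, e1] using hrel
        exact (smul_eq_zero.1 h1).resolve_right hp0
      apply he
      funext i
      fin_cases i <;> assumption
    -- `φ` separates `l` from `x` and takes different slopes at `y` and `z`
    obtain ⟨φ, hφl, hφx, hφp⟩ : ∃ φ : Module.Dual ℝ E3, φ l < φ d ∧ φ d < φ x ∧ φ p ≠ 0 := by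
      by_cases h : (ψ₂ - ψ₁) p = 0
      · refine ⟨2 • ψ₂ - ψ₁, ?_, ?_, ?_⟩
        · simp only [LinearMap.sub_apply, LinearMap.smul_apply, nsmul_eq_mul, Nat.cast_ofNat]
          linarith
        · simp only [LinearMap.sub_apply, LinearMap.smul_apply, nsmul_eq_mul, Nat.cast_ofNat]
          linarith
        · simp only [LinearMap.sub_apply, LinearMap.smul_apply, nsmul_eq_mul,
            Nat.cast_ofNat] at h ⊢
          intro h'
          rcases hψp with hn | hn
          · exact hn (by linarith)
          · exact hn (by linarith)
      · refine ⟨ψ₂ - ψ₁, ?_, ?_, h⟩ <;>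
        · simp only [LinearMap.sub_apply]
          linarith
    have hA : 0 < c - m y := sub_pos.2 hmy
    have hB : 0 < c - m z := sub_pos.2 hmz
    have hφp' : φ p = (c - m z) * (φ y - φ d) - (c - m y) * (φ z - φ d) := by
      simp [hp]
    -- the mean of the slopes at `y` and `z` puts them on different sides
    set K := ((φ y - φ d) / (c - m y) + (φ z - φ d) / (c - m z)) / 2 with hK
    have hy1 : (φ y - φ d) / (c - m y) * (c - m y) = φ y - φ d := div_mul_cancel₀ _ hA.ne'
    have hz1 : (φ z - φ d) / (c - m z) * (c - m z) = φ z - φ d := div_mul_cancel₀ _ hB.ne'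
    set s := (φ y - φ d) / (c - m y) with hs
    set t := (φ z - φ d) / (c - m z) with ht
    have hst : s ≠ t := by
      intro e
      apply hφp
      rw [hφp', ← hy1, ← hz1, e]
      ring
    have hτc : Crosses (φ + K • m) τ d := by
      refine ⟨⟨l, hl, ?_⟩, x, hx, ?_⟩ <;>
      · simp only [LinearMap.add_apply, LinearMap.smul_apply, smul_eq_mul, hmx, hmd, hml]
        linarith
    refine ⟨φ + K • m, hτc, ?_⟩
    have hyv : (φ + K • m) y - (φ + K • m) d = (c - m y) * ((s - t) / 2) := by
      simp only [LinearMap.add_apply, LinearMap.smul_apply, smul_eq_mul, hmd, hK]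
      linear_combination -hy1
    have hzv : (φ + K • m) z - (φ + K • m) d = (c - m z) * ((t - s) / 2) := by
      simp only [LinearMap.add_apply, LinearMap.smul_apply, smul_eq_mul, hmd, hK]
      linear_combination -hz1
    rcases lt_or_gt_of_ne hst with h | h
    · refine ⟨⟨y, hy.2, ?_⟩, z, hz.2, ?_⟩
      · have : (c - m y) * ((s - t) / 2) < 0 := mul_neg_of_pos_of_neg hA (by linarith)
        linarith
      · have : 0 < (c - m z) * ((t - s) / 2) := mul_pos hB (by linarith)
        linarith
    · refine ⟨⟨z, hz.2, ?_⟩, y, hy.2, ?_⟩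
      · have : (c - m z) * ((t - s) / 2) < 0 := mul_neg_of_pos_of_neg hB (by linarith)
        linarith
      · have : 0 < (c - m y) * ((s - t) / 2) := mul_pos hA (by linarith)
        linarith

open Classical in
/-- More than `2 * m` facets meet the complement of `D`, where `m` is the size of the
complement. -/
theorem SimplicialVertexSet.two_mul_card_sdiff_lt {V : Finset E3} (hV : SimplicialVertexSet V)
    {D : Finset E3} (hD : D ⊆ V) (hcard : 3 ≤ D.card) (hne : D ≠ V) :
    2 * (V \ D).card < ((facets V).filter fun τ => ¬ τ ⊆ D).card := by
  obtain ⟨τ, hτ, ⟨d, hd, hdD⟩, l, hl, hlD⟩ := hV.exists_mixed_facet hD (by omega) hne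
  obtain ⟨h, hinj, hcr, hdn⟩ := hV.exists_crosses_nonextreme hD hcard hτ hd hdD hl hlD
  have h1 := (hV.card_facets_subset_le hinj hD).2 d hdn ⟨τ, hτ, fun hsub => hlD (hsub hl), hd, hcr⟩
  have h2 := card_nonextreme_add_two_le h (hinj.mono hD) (by omega)
  have h3 := hV.two_mul_card_le
  have h4 := Finset.card_sdiff_add_card_eq_card hD
  have h5 := Finset.card_filter_add_card_filter_not (s := facets V) (fun τ => τ ⊆ D)
  omega

/-! ### Dehn's theorem -/

open Classical in
/-- Twice the number of sign changes which the functional `h`, based at `v`, makes in the angle of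
the triangle `τ` at `v`. An edge on the level of `h` counts as half a sign change in each of its two
angles. -/
noncomputable def angleWeight (h : Module.Dual ℝ E3) (τ : Finset E3) (v : E3) : ℕ :=
  (if Crosses h τ v then 2 else 0) + (τ.filter fun w => w ≠ v ∧ h w = h v).card

open Classical in
/-- Around a convex vertex a nonzero functional changes sign at most twice. -/
theorem SimplicialVertexSet.sum_angleWeight_le_four {V : Finset E3} (hV : SimplicialVertexSet V)
    {v : E3} (hv : v ∈ V) {h : Module.Dual ℝ E3} (hh : h ≠ 0) :
    ∑ τ ∈ (facets V).filter (fun τ => v ∈ τ), angleWeight h τ v ≤ 4 := by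
  have h1 := hV.card_crosses_add_card_level_le_two hv hh
  set X := (facets V).filter fun τ => v ∈ τ ∧ Crosses h τ v with hX
  set Z := V.filter fun w => w ≠ v ∧ h w = h v ∧ ∃ τ ∈ facets V, v ∈ τ ∧ w ∈ τ with hZ
  set T := (facets V).filter (fun τ => v ∈ τ) with hT
  have h2 : ∑ τ ∈ T, (if Crosses h τ v then 2 else 0) = 2 * X.card := by
    rw [← Finset.sum_filter, hT, Finset.filter_filter]
    simp [hX, mul_comm]
  have h3 : ∑ τ ∈ T, (τ.filter fun w => w ≠ v ∧ h w = h v).card ≤ 2 * Z.card := by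
    have e1 : ∀ τ ∈ T, (τ.filter fun w => w ≠ v ∧ h w = h v).card =
        (Z.filter fun w => w ∈ τ).card := by
      intro τ hτ
      obtain ⟨hτf, hvτ⟩ := Finset.mem_filter.1 hτ
      congr 1
      ext w
      simp only [hZ, Finset.mem_filter]
      constructor
      · rintro ⟨hw, hwv, hwl⟩
        exact ⟨⟨(mem_facets.1 hτf).2.1 hw, hwv, hwl, τ, hτf, hvτ, hw⟩, hw⟩
      · rintro ⟨⟨-, hwv, hwl, -⟩, hw⟩
        exact ⟨hw, hwv, hwl⟩
    rw [Finset.sum_congr rfl e1]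
    have e2 := Finset.sum_card_bipartiteAbove_eq_sum_card_bipartiteBelow (s := T) (t := Z)
      (fun τ w => w ∈ τ)
    simp only [Finset.bipartiteAbove, Finset.bipartiteBelow] at e2
    rw [e2]
    calc _ ≤ ∑ w ∈ Z, 2 := by
          refine Finset.sum_le_sum fun w hw => ?_
          obtain ⟨-, hwv, -⟩ := Finset.mem_filter.1 hw
          have := hV.card_facets_through_edge_le_two (Ne.symm hwv)
          rwa [hT, Finset.filter_filter]
      _ = 2 * Z.card := by simp [mul_comm]
  simp only [angleWeight]
  rw [Finset.sum_add_distrib]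
  omega

/-- The functional `w ↦ ⟪x, w⟫`. Its level through a vertex with velocity `x` separates the edges
that the motion of the vertex shortens from those that it lengthens. -/
noncomputable def velocityDual (x : E3) : Module.Dual ℝ E3 := innerₗ E3 x

theorem velocityDual_apply (x y : E3) : velocityDual x y = inner ℝ x y := rfl

theorem velocityDual_ne_zero {x : E3} (hx : x ≠ 0) : velocityDual x ≠ 0 := by
  intro h
  have := congrArg (fun l => l x) h
  simp [velocityDual_apply, hx] at this

/-- `a` is an infinitesimal flex of `V`: it preserves to first order the lengths of all sides of the
facets. -/
def IsInfinitesimalFlex (V : Finset E3) (a : E3 → E3) : Prop :=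
  ∀ τ ∈ facets V, ∀ u ∈ τ, ∀ v ∈ τ, inner ℝ (u - v) (a u - a v) = 0

open Classical in
/-- A triangle with a moving vertex has at least one sign change at its moving vertices: when two
sides meeting at `x` point the same way (both out of or both into `x`), the third side yields a sign
change at one of its ends. A side with value zero contributes a half at each end, and a dead vertex
gives two such sides. -/
theorem two_le_sum_angleWeight {V : Finset E3} {a : E3 → E3} (ha : IsInfinitesimalFlex V a)
    {τ : Finset E3} (hτ : τ ∈ facets V) (hlive : ∃ v ∈ τ, a v ≠ 0) :
    2 ≤ ∑ v ∈ τ.filter (fun v => a v ≠ 0), angleWeight (velocityDual (a v)) τ v := by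
  set s : E3 → E3 → ℝ := fun v w => velocityDual (a v) w - velocityDual (a v) v with hs
  have anti : ∀ u ∈ τ, ∀ v ∈ τ, s u v = - s v u := by
    intro u hu v hv
    have := ha τ hτ u hu v hv
    simp only [inner_sub_left, inner_sub_right] at this
    simp only [hs, velocityDual_apply, real_inner_comm]
    linarith [real_inner_comm (a u) u, real_inner_comm (a u) v, real_inner_comm (a v) u,
      real_inner_comm (a v) v]
  have hcross : ∀ u ∈ τ, ∀ v ∈ τ, ∀ w ∈ τ, 0 < s u v → s u w < 0 →
      2 ≤ angleWeight (velocityDual (a u)) τ u := by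
    intro u _ v hv w hw h1 h2
    have : Crosses (velocityDual (a u)) τ u := ⟨⟨w, hw, by linarith⟩, v, hv, by linarith⟩
    simp [angleWeight, this]
  have hzero : ∀ u ∈ τ, ∀ v ∈ τ, u ≠ v → s u v = 0 →
      1 ≤ angleWeight (velocityDual (a u)) τ u := by
    intro u _ v hv huv h
    refine le_trans ?_ (Nat.le_add_left _ _)
    exact Finset.card_pos.2 ⟨v, Finset.mem_filter.2 ⟨hv, huv.symm, sub_eq_zero.1 h⟩⟩
  have hzero2 : ∀ u ∈ τ, ∀ v ∈ τ, ∀ w ∈ τ, u ≠ v → u ≠ w → v ≠ w → s u v = 0 → s u w = 0 →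
      2 ≤ angleWeight (velocityDual (a u)) τ u := by
    intro u _ v hv w hw huv huw hvw h h'
    refine le_trans ?_ (Nat.le_add_left _ _)
    exact Finset.one_lt_card.2 ⟨v, Finset.mem_filter.2 ⟨hv, huv.symm, sub_eq_zero.1 h⟩,
      w, Finset.mem_filter.2 ⟨hw, huw.symm, sub_eq_zero.1 h'⟩, hvw⟩
  have single : ∀ u ∈ τ, a u ≠ 0 → 2 ≤ angleWeight (velocityDual (a u)) τ u →
      2 ≤ ∑ v ∈ τ.filter (fun v => a v ≠ 0), angleWeight (velocityDual (a v)) τ v := by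
    intro u hu hau h
    exact h.trans (Finset.single_le_sum
      (f := fun v => angleWeight (velocityDual (a v)) τ v) (fun _ _ => Nat.zero_le _)
      (Finset.mem_filter.2 ⟨hu, hau⟩))
  have pair : ∀ u ∈ τ, ∀ v ∈ τ, u ≠ v → a u ≠ 0 → a v ≠ 0 →
      1 ≤ angleWeight (velocityDual (a u)) τ u → 1 ≤ angleWeight (velocityDual (a v)) τ v →
      2 ≤ ∑ v ∈ τ.filter (fun v => a v ≠ 0), angleWeight (velocityDual (a v)) τ v := by
    intro u hu v hv huv hau hav h h'
    have hsub : ({u, v} : Finset E3) ⊆ τ.filter (fun v => a v ≠ 0) := by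
      simp [Finset.insert_subset_iff, hu, hv, hau, hav]
    have := Finset.sum_le_sum_of_subset
      (f := fun v => angleWeight (velocityDual (a v)) τ v) hsub
    rw [Finset.sum_pair huv] at this
    omega
  have dead : ∀ u ∈ τ, ∀ v ∈ τ, a u = 0 → s v u = 0 := by
    intro u hu v hv h
    rw [anti v hv u hu]
    simp [hs, h, velocityDual_apply]
  have hcard := (mem_facets.1 hτ).1
  obtain ⟨x, hx, hax⟩ := hlive
  obtain ⟨y, hy, hyx, -⟩ := exists_third hcard x x
  obtain ⟨z, hz, hzx, hzy⟩ := exists_third hcard x y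
  by_cases hay : a y = 0
  · by_cases haz : a z = 0
    · exact single x hx hax (hzero2 x hx y hy z hz hyx.symm hzx.symm hzy.symm
        (dead y hy x hx hay) (dead z hz x hx haz))
    · exact pair x hx z hz hzx.symm hax haz (hzero x hx y hy hyx.symm (dead y hy x hx hay))
        (hzero z hz y hy hzy (dead y hy z hz hay))
  by_cases haz : a z = 0
  · exact pair x hx y hy hyx.symm hax hay (hzero x hx z hz hzx.symm (dead z hz x hx haz))
      (hzero y hy z hz hzy.symm (dead z hz y hy haz))
  have eyx := anti y hy x hx
  have ezx := anti z hz x hx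
  have ezy := anti z hz y hy
  have zeropair : ∀ u ∈ τ, ∀ v ∈ τ, u ≠ v → a u ≠ 0 → a v ≠ 0 → s u v = 0 →
      2 ≤ ∑ v ∈ τ.filter (fun v => a v ≠ 0), angleWeight (velocityDual (a v)) τ v := by
    intro u hu v hv huv hau hav h
    exact pair u hu v hv huv hau hav (hzero u hu v hv huv h)
      (hzero v hv u hu huv.symm (by rw [anti v hv u hu, h, neg_zero]))
  rcases lt_trichotomy (s x y) 0 with hxy | hxy | hxy
  · rcases lt_trichotomy (s x z) 0 with hxz | hxz | hxz
    · rcases lt_trichotomy (s y z) 0 with hyz | hyz | hyz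
      · exact single y hy hay (hcross y hy x hx z hz (by linarith) hyz)
      · exact zeropair y hy z hz hzy.symm hay haz hyz
      · exact single z hz haz (hcross z hz x hx y hy (by linarith) (by linarith))
    · exact zeropair x hx z hz hzx.symm hax haz hxz
    · exact single x hx hax (hcross x hx z hz y hy hxz hxy)
  · exact zeropair x hx y hy hyx.symm hax hay hxy
  · rcases lt_trichotomy (s x z) 0 with hxz | hxz | hxz
    · exact single x hx hax (hcross x hx y hy z hz hxy hxz)
    · exact zeropair x hx z hz hzx.symm hax haz hxz
    · rcases lt_trichotomy (s y z) 0 with hyz | hyz | hyz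
      · exact single z hz haz (hcross z hz y hy x hx (by linarith) (by linarith))
      · exact zeropair y hy z hz hzy.symm hay haz hyz
      · exact single y hy hay (hcross y hy z hz x hx hyz (by linarith))

open Classical in
/-- **Dehn's theorem**: an infinitesimal flex of a simplicial polytope that fixes the vertices of a
facet vanishes. Otherwise the facets with moving vertices are too many for the sign changes
available at the moving vertices. -/
theorem SimplicialVertexSet.flex_eq_zero {V : Finset E3} (hV : SimplicialVertexSet V)
    {a : E3 → E3} (ha : IsInfinitesimalFlex V a) {τ₀ : Finset E3} (hτ₀ : τ₀ ∈ facets V)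
    (h₀ : ∀ v ∈ τ₀, a v = 0) : ∀ v ∈ V, a v = 0 := by
  by_contra hcon
  push Not at hcon
  obtain ⟨u, hu, hau⟩ := hcon
  set D := V.filter fun v => a v = 0 with hD
  have hDV : D ⊆ V := Finset.filter_subset _ _
  obtain ⟨hcard₀, hsub₀, -⟩ := mem_facets.1 hτ₀
  have hD3 : 3 ≤ D.card := by
    rw [← hcard₀]
    exact Finset.card_le_card fun v hv => Finset.mem_filter.2 ⟨hsub₀ hv, h₀ v hv⟩
  have hne : D ≠ V := by
    intro e
    rw [← e] at hu
    exact hau (Finset.mem_filter.1 hu).2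
  have h1 := hV.two_mul_card_sdiff_lt hDV hD3 hne
  set 𝓣 := (facets V).filter fun τ => ¬ τ ⊆ D with h𝓣
  have h2 : 2 * 𝓣.card ≤ ∑ τ ∈ 𝓣, ∑ v ∈ τ.filter (fun v => a v ≠ 0),
      angleWeight (velocityDual (a v)) τ v := by
    calc 2 * 𝓣.card = ∑ τ ∈ 𝓣, 2 := by simp [mul_comm]
      _ ≤ _ := by
        refine Finset.sum_le_sum fun τ hτ => ?_
        obtain ⟨hτf, hτD⟩ := Finset.mem_filter.1 hτ
        obtain ⟨v, hv, hvD⟩ := Finset.not_subset.1 hτD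
        refine two_le_sum_angleWeight ha hτf ⟨v, hv, fun h => hvD ?_⟩
        exact Finset.mem_filter.2 ⟨(mem_facets.1 hτf).2.1 hv, h⟩
  have h3 : ∑ τ ∈ 𝓣, ∑ v ∈ τ.filter (fun v => a v ≠ 0), angleWeight (velocityDual (a v)) τ v =
      ∑ v ∈ V \ D, ∑ τ ∈ (facets V).filter (fun τ => v ∈ τ),
        angleWeight (velocityDual (a v)) τ v := by
    refine Finset.sum_comm' fun τ v => ?_
    simp only [h𝓣, hD, Finset.mem_filter, Finset.mem_sdiff, not_and]
    constructor
    · rintro ⟨⟨hτ, -⟩, hv, hav⟩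
      exact ⟨⟨hτ, hv⟩, (mem_facets.1 hτ).2.1 hv, fun _ => hav⟩
    · rintro ⟨⟨hτ, hv⟩, hvV, hav⟩
      exact ⟨⟨hτ, fun hsub => hav hvV (Finset.mem_filter.1 (hsub hv)).2⟩, hv, hav hvV⟩
  have h4 : ∑ v ∈ V \ D, ∑ τ ∈ (facets V).filter (fun τ => v ∈ τ),
      angleWeight (velocityDual (a v)) τ v ≤ ∑ v ∈ V \ D, 4 := by
    refine Finset.sum_le_sum fun v hv => ?_
    obtain ⟨hvV, hvD⟩ := Finset.mem_sdiff.1 hv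
    refine hV.sum_angleWeight_le_four hvV (velocityDual_ne_zero fun h => hvD ?_)
    exact Finset.mem_filter.2 ⟨hvV, h⟩
  simp only [Finset.sum_const, smul_eq_mul] at h4
  omega

/-- `V` is not coplanar, so it has at least three points, and the facet count is positive. -/
theorem SimplicialVertexSet.facets_nonempty {V : Finset E3} (hV : SimplicialVertexSet V) :
    (facets V).Nonempty := by
  suffices 3 ≤ V.card by
    rw [← Finset.card_pos]
    have := hV.two_mul_card_le
    omega
  -- two points always lie in a common plane
  by_contra! hcard
  have hpq : ∃ p q : E3, ∀ x ∈ V, x = p ∨ x = q := by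
    have : V.card = 0 ∨ V.card = 1 ∨ V.card = 2 := by omega
    rcases this with h | h | h
    · exact ⟨0, 0, by simp [Finset.card_eq_zero.1 h]⟩
    · obtain ⟨p, rfl⟩ := Finset.card_eq_one.1 h
      exact ⟨p, p, by simp⟩
    · classical
      obtain ⟨p, q, -, rfl⟩ := Finset.card_eq_two.1 h
      exact ⟨p, q, by simp⟩
  obtain ⟨p, q, hpq⟩ := hpq
  obtain ⟨l, hl, hl0⟩ : ∃ l ∈ LinearMap.ker (Module.Dual.eval ℝ E3 (p - q)), l ≠ 0 := by
    apply Submodule.exists_mem_ne_zero_of_ne_bot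
    apply LinearMap.ker_ne_bot_of_finrank_lt
    rw [Subspace.dual_finrank_eq]
    simp
  have hl' : l p = l q := by simpa [sub_eq_zero] using hl
  obtain ⟨x, hx, hxl⟩ := hV.exists_ne l hl0 (l q)
  rcases hpq x hx with rfl | rfl
  · exact hxl hl'
  · exact hxl rfl

/-! ### Faces of simplicial polytopes -/

namespace Polytope3

theorem IsConvexPolytope.finite_vertices {P : Set E3} (hP : IsConvexPolytope P) :
    (vertices P).Finite := by
  obtain ⟨⟨s, hs, rfl⟩, -⟩ := hP
  exact hs.subset extremePoints_convexHull_subset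

theorem IsConvexPolytope.isCompact {P : Set E3} (hP : IsConvexPolytope P) : IsCompact P := by
  obtain ⟨⟨s, hs, rfl⟩, -⟩ := hP
  exact hs.isCompact_convexHull ℝ

theorem IsConvexPolytope.convex {P : Set E3} (hP : IsConvexPolytope P) : Convex ℝ P := by
  obtain ⟨⟨s, hs, rfl⟩, -⟩ := hP
  exact convex_convexHull ℝ s

theorem IsConvexPolytope.convexHull_vertices {P : Set E3} (hP : IsConvexPolytope P) :
    convexHull ℝ (vertices P) = P := by
  rw [← (hP.finite_vertices.isClosed_convexHull (𝕜 := ℝ)).closure_eq]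
  exact closure_convexHull_extremePoints hP.isCompact hP.convex

theorem IsConvexPolytope.le_of_forall_vertices {P : Set E3} (hP : IsConvexPolytope P)
    {l : Module.Dual ℝ E3} {c : ℝ} (h : ∀ v ∈ vertices P, l v ≤ c) : ∀ x ∈ P, l x ≤ c := by
  intro x hx
  rw [← hP.convexHull_vertices] at hx
  exact convexHull_min (t := {x | l x ≤ c}) h (convex_halfSpace_le l.isLinear c) hx

theorem vertices_subset {P : Set E3} : vertices P ⊆ P := extremePoints_subset

theorem IsConvexPolytope.exists_exposing {P : Set E3} (hP : IsConvexPolytope P) :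
    ∀ v ∈ vertices P, ∃ g : Module.Dual ℝ E3, ∀ w ∈ vertices P, w ≠ v → g v < g w := by
  intro v hv
  have hv' := (hP.convex.mem_extremePoints_iff_mem_sdiff_convexHull_sdiff.1 hv).2
  have hsub : convexHull ℝ (vertices P \ {v}) ⊆ convexHull ℝ (P \ {v}) :=
    convexHull_mono (Set.sdiff_subset_sdiff_left vertices_subset)
  obtain ⟨f, u, hfu, hf⟩ := geometric_hahn_banach_point_closed
    (convex_convexHull ℝ (vertices P \ {v}))
    ((hP.finite_vertices.subset Set.sdiff_subset).isClosed_convexHull (𝕜 := ℝ))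
    (fun h => hv' (hsub h))
  refine ⟨f.toLinearMap, fun w hw hwv => hfu.trans (hf w (subset_convexHull ℝ _ ⟨hw, hwv⟩))⟩

/-- The points of a polytope where a functional attains its maximum `c` form a face. -/
theorem isFace_of_le {P : Set E3} {l : Module.Dual ℝ E3} {c : ℝ} (h : ∀ x ∈ P, l x ≤ c) :
    IsFace P {x ∈ P | l x = c} := by
  rintro ⟨y, hy, hyc⟩
  refine ⟨LinearMap.toContinuousLinearMap l, ?_⟩
  ext x
  simp only [Set.mem_ofPred_eq, LinearMap.coe_toContinuousLinearMap']
  constructor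
  · rintro ⟨hx, hxc⟩
    exact ⟨hx, fun z hz => by rw [hxc]; exact h z hz⟩
  · rintro ⟨hx, hxm⟩
    exact ⟨hx, le_antisymm (h x hx) (by rw [← hyc]; exact hxm y hy)⟩

theorem vertices_inter_face_subset {P F s : Set E3} (hFP : F ⊆ P) (hF : F = convexHull ℝ s) :
    F ∩ vertices P ⊆ s := by
  intro x hx
  have := inter_extremePoints_subset_extremePoints_of_subset (𝕜 := ℝ) hFP hx
  rw [hF] at this
  exact extremePoints_convexHull_subset this

theorem finrank_vectorSpan_eq_two {F : Set E3} {l : Module.Dual ℝ E3} (hl : l ≠ 0) {c : ℝ}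
    (hF : ∀ x ∈ F, l x = c) {p q r : E3} (hp : p ∈ F) (hq : q ∈ F) (hr : r ∈ F) (hpq : p ≠ q)
    (hn : r - p ∉ Submodule.span ℝ {q - p}) : Module.finrank ℝ (vectorSpan ℝ F) = 2 := by
  apply le_antisymm
  · have hker : Module.finrank ℝ (LinearMap.ker l) = 2 := by
      have := Module.Dual.finrank_ker_add_one_of_ne_zero hl
      simp at this
      omega
    rw [← hker]
    apply Submodule.finrank_mono
    rw [vectorSpan_def, Submodule.span_le]
    rintro _ ⟨x, hx, y, hy, rfl⟩
    simp [hF x hx, hF y hy]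
  · have hli : LinearIndependent ℝ ![q - p, r - p] := by
      rw [LinearIndependent.pair_iff' (sub_ne_zero.2 hpq.symm)]
      intro a ha
      exact hn (Submodule.mem_span_singleton.2 ⟨a, ha⟩)
    have hspan : Submodule.span ℝ (Set.range ![q - p, r - p]) ≤ vectorSpan ℝ F := by
      rw [Submodule.span_le]
      rintro _ ⟨i, rfl⟩
      fin_cases i
      · exact vsub_mem_vectorSpan ℝ hq hp
      · exact vsub_mem_vectorSpan ℝ hr hp
    have := Submodule.finrank_mono hspan
    rwa [finrank_span_eq_card hli, Fintype.card_fin] at this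

theorem exists_ne_of_interior_nonempty {P : Set E3} (hP : (interior P).Nonempty)
    {l : Module.Dual ℝ E3} (hl : l ≠ 0) (c : ℝ) : ∃ x ∈ P, l x ≠ c := by
  by_contra! h
  obtain ⟨x, hx⟩ := hP
  obtain ⟨u, hu⟩ : ∃ u, l u ≠ 0 := by
    by_contra! h0
    exact hl (LinearMap.ext h0)
  have hcont : Filter.Tendsto (fun t : ℝ => x + t • u) (nhds 0) (nhds x) := by
    have : Continuous fun t : ℝ => x + t • u := by fun_prop
    simpa using this.tendsto 0
  have hev : ∀ᶠ t in nhdsWithin (0 : ℝ) {0}ᶜ, x + t • u ∈ P :=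
    nhdsWithin_le_nhds (hcont (mem_interior_iff_mem_nhds.1 hx))
  obtain ⟨t, ht, ht0⟩ := (hev.and self_mem_nhdsWithin).exists
  have h1 := h _ ht
  rw [map_add, map_smul, h x (interior_subset hx), smul_eq_mul] at h1
  have : t * l u = 0 := by linarith
  exact (mul_ne_zero ht0 hu) this

theorem simplicialVertexSet {P : Set E3} (hP : IsConvexPolytope P) (hs : IsSimplicial P)
    {V : Finset E3} (hV : (V : Set E3) = vertices P) : SimplicialVertexSet V := by
  classical
  have mem : ∀ x, x ∈ V ↔ x ∈ vertices P := fun x => by rw [← hV, Finset.mem_coe]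
  refine ⟨?_, ?_, ?_⟩
  · intro v hv
    obtain ⟨g, hg⟩ := hP.exists_exposing v ((mem v).1 hv)
    exact ⟨g, fun w hw => hg w ((mem w).1 hw)⟩
  · intro l hl c hle
    by_contra! hcard
    obtain ⟨p, hp, q, hq, r, hr, hpq, hpr, hqr⟩ :=
      Finset.two_lt_card.1 (lt_of_le_of_lt (by norm_num) hcard)
    rw [Finset.mem_filter, mem] at hp hq hr
    have hleP := hP.le_of_forall_vertices fun v hv => hle v ((mem v).2 hv)
    have hfacet : IsFacet P {x ∈ P | l x = c} := by
      refine ⟨isFace_of_le hleP, finrank_vectorSpan_eq_two hl (c := c) (fun x hx => hx.2)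
        (p := p) (q := q) (r := r) ⟨vertices_subset hp.1, hp.2⟩ ⟨vertices_subset hq.1, hq.2⟩
        ⟨vertices_subset hr.1, hr.2⟩ hpq ?_⟩
      exact sub_notMem_span_of_exposed hP.exists_exposing hp.1 hq.1 hr.1 hpq hpr hqr
    obtain ⟨t, -, ht⟩ := hs _ hfacet
    have hsub := vertices_inter_face_subset (fun x hx => hx.1) ht
    have : (V.filter fun x => l x = c) ⊆ Finset.univ.image t := by
      intro x hx
      rw [Finset.mem_filter, mem] at hx
      obtain ⟨i, hi⟩ := hsub ⟨⟨vertices_subset hx.1, hx.2⟩, hx.1⟩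
      exact Finset.mem_image.2 ⟨i, Finset.mem_univ _, hi⟩
    have h1 := Finset.card_le_card this
    have h2 : (Finset.univ.image t).card ≤ 3 := by
      simpa using Finset.card_image_le (s := Finset.univ) (f := t)
    omega
  · intro l hl c
    by_contra! h
    obtain ⟨x, hx, hxc⟩ := exists_ne_of_interior_nonempty hP.2 hl c
    apply hxc
    apply le_antisymm
    · exact hP.le_of_forall_vertices (fun v hv => (h v ((mem v).2 hv)).le) x hx
    · have := hP.le_of_forall_vertices (l := -l) (c := -c)
        (fun v hv => by simp [h v ((mem v).2 hv)]) x hx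
      simpa using this

/-- The sides of the facets are edges of the polytope. -/
theorem isEdge_of_mem_facets {P : Set E3} (hP : IsConvexPolytope P) (hs : IsSimplicial P)
    {V : Finset E3} (hV : (V : Set E3) = vertices P) {τ : Finset E3} (hτ : τ ∈ facets V)
    {u v : E3} (hu : u ∈ τ) (hv : v ∈ τ) (huv : u ≠ v) : IsEdge P u v := by
  classical
  have mem : ∀ x, x ∈ V ↔ x ∈ vertices P := fun x => by rw [← hV, Finset.mem_coe]
  obtain ⟨hsub, l, c, hl, hl'⟩ :=
    (simplicialVertexSet hP hs hV).isExposedSubset_pair hτ hu hv huv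
  have huP := (mem u).1 (hsub (by simp))
  have hvP := (mem v).1 (hsub (by simp))
  refine ⟨huP, hvP, huv, ?_⟩
  have hle : ∀ x ∈ P, l x ≤ c := by
    refine hP.le_of_forall_vertices fun x hx => ?_
    by_cases h : x ∈ ({u, v} : Finset E3)
    · exact (hl x h).le
    · exact (hl' x ((mem x).2 hx) h).le
  have hface := isFace_of_le hle
  have hlu := hl u (by simp)
  have hlv := hl v (by simp)
  suffices segment ℝ u v = {x ∈ P | l x = c} by
    rw [this]
    exact hface
  have hFc : Convex ℝ {x ∈ P | l x = c} := hP.convex.inter (convex_hyperplane l.isLinear c)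
  apply Set.Subset.antisymm
  · exact hFc.segment_subset ⟨vertices_subset huP, hlu⟩ ⟨vertices_subset hvP, hlv⟩
  · have hcomp : IsCompact {x ∈ P | l x = c} := IsExposed.isCompact hface hP.isCompact
    rw [← closure_convexHull_extremePoints hcomp hFc, IsExtreme.extremePoints_eq
      (IsExposed.isExtreme hface), ← convexHull_pair]
    apply closure_minimal _ ((Set.toFinite {u, v}).isClosed_convexHull (𝕜 := ℝ))
    apply convexHull_mono
    rintro x ⟨⟨-, hxc⟩, hxP⟩
    by_contra hx
    exact (hl' x ((mem x).2 hxP) (by simpa using hx)).ne hxc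

end Polytope3

/-! ### From infinitesimal to continuous rigidity -/

open Classical in
/-- Frameworks near a simplicial polytope have no infinitesimal flex that fixes a given facet: the
condition on the flex is closed and the unit sphere of velocities is compact. -/
theorem SimplicialVertexSet.eventually_flex_eq_zero {V : Finset E3} (hV : SimplicialVertexSet V)
    {τ₀ : Finset E3} (hτ₀ : τ₀ ∈ facets V) :
    ∀ᶠ m : V → E3 in nhds (fun v => (v : E3) + v), ∀ a : V → E3,
      (∀ τ ∈ facets V, ∀ u v : V, (u : E3) ∈ τ → (v : E3) ∈ τ →
        inner ℝ (m u - m v) (a u - a v) = 0) →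
      (∀ v : V, (v : E3) ∈ τ₀ → a v = 0) → a = 0 := by
  let E : Finset (V × V) := Finset.univ.filter fun e =>
    ∃ τ ∈ facets V, (e.1 : E3) ∈ τ ∧ (e.2 : E3) ∈ τ
  let S : Finset V := Finset.univ.filter fun v => (v : E3) ∈ τ₀
  -- `Φ (m, a)` vanishes exactly when `a` is a flex of `m` that fixes the facet
  let Φ : (V → E3) × (V → E3) → ℝ := fun p =>
    ∑ e ∈ E, (inner ℝ (p.1 e.1 - p.1 e.2) (p.2 e.1 - p.2 e.2)) ^ 2 + ∑ v ∈ S, ‖p.2 v‖ ^ 2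
  have hΦ : Continuous Φ := by
    simp only [Φ]
    fun_prop
  have hev := (isCompact_sphere (0 : V → E3) 1).eventually_forall_of_forall_eventually
    (x₀ := fun v : V => (v : E3) + v) (P := fun m a => Φ (m, a) ≠ 0) (by
      intro a ha
      refine hΦ.continuousAt.eventually_ne ?_
      intro h0
      have h1 : ∑ e ∈ E, (inner ℝ (((e.1 : E3) + e.1) - ((e.2 : E3) + e.2)) (a e.1 - a e.2)) ^ 2 +
          ∑ v ∈ S, ‖a v‖ ^ 2 = 0 := h0
      have hE : 0 ≤ ∑ e ∈ E,
          (inner ℝ (((e.1 : E3) + e.1) - ((e.2 : E3) + e.2)) (a e.1 - a e.2)) ^ 2 :=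
        Finset.sum_nonneg fun _ _ => sq_nonneg _
      have hS : 0 ≤ ∑ v ∈ S, ‖a v‖ ^ 2 := Finset.sum_nonneg fun _ _ => sq_nonneg _
      have hE0 := (Finset.sum_eq_zero_iff_of_nonneg fun _ _ => sq_nonneg _).1
        (show _ = (0 : ℝ) by linarith : ∑ e ∈ E,
          (inner ℝ (((e.1 : E3) + e.1) - ((e.2 : E3) + e.2)) (a e.1 - a e.2)) ^ 2 = 0)
      have hS0 := (Finset.sum_eq_zero_iff_of_nonneg fun _ _ => sq_nonneg _).1
        (show _ = (0 : ℝ) by linarith : ∑ v ∈ S, ‖a v‖ ^ 2 = 0)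
      let b : E3 → E3 := fun x => if h : x ∈ V then a ⟨x, h⟩ else 0
      have hb : ∀ v : V, b v = a v := fun v => by simp [b]
      have hzero : ∀ v ∈ V, b v = 0 := by
        refine hV.flex_eq_zero ?_ hτ₀ ?_
        · intro τ hτ u hu v hv
          have hsub := (mem_facets.1 hτ).2.1
          have h2 := hE0 (⟨u, hsub hu⟩, ⟨v, hsub hv⟩)
            (Finset.mem_filter.2 ⟨Finset.mem_univ _, τ, hτ, hu, hv⟩)
          have h3 := pow_eq_zero_iff (two_ne_zero) |>.1 h2
          rw [← hb, ← hb, add_sub_add_comm, inner_add_left] at h3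
          dsimp only at h3
          linarith
        · intro v hv
          have hvV := (mem_facets.1 hτ₀).2.1 hv
          have h2 := hS0 ⟨v, hvV⟩ (Finset.mem_filter.2 ⟨Finset.mem_univ _, hv⟩)
          rw [← hb] at h2
          simpa using h2
      have ha0 : a = 0 := funext fun v => by rw [← hb, hzero v v.2]; rfl
      rw [ha0] at ha
      simp at ha)
  filter_upwards [hev] with m hm a hflex hfix
  by_contra ha
  have hn : ‖a‖ ≠ 0 := norm_ne_zero_iff.2 ha
  refine hm (‖a‖⁻¹ • a) (by simp [norm_smul, hn]) ?_
  have e1 : ∀ e ∈ E, (inner ℝ (m e.1 - m e.2) ((‖a‖⁻¹ • a) e.1 - (‖a‖⁻¹ • a) e.2)) ^ 2 = 0 := by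
    intro e he
    obtain ⟨-, τ, hτ, hu, hv⟩ := Finset.mem_filter.1 he
    rw [Pi.smul_apply, Pi.smul_apply, ← smul_sub, inner_smul_right, hflex τ hτ _ _ hu hv]
    simp
  have e2 : ∀ v ∈ S, ‖(‖a‖⁻¹ • a) v‖ ^ 2 = 0 := by
    intro v hv
    rw [Pi.smul_apply, hfix v (Finset.mem_filter.1 hv).2]
    simp
  simp only [Φ]
  rw [Finset.sum_eq_zero e1, Finset.sum_eq_zero e2, add_zero]

/-- A continuous motion of the vertices that keeps the side lengths of all facets and fixes one
facet is constant. If `q` is a nearby position with the same lengths, then `q - p` is an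
infinitesimal flex of `q + p`, because
`‖q u - q v‖² - ‖u - v‖² = ⟪(q u + u) - (q v + v), (q u - u) - (q v - v)⟫`. -/
theorem SimplicialVertexSet.eq_of_continuous {V : Finset E3} (hV : SimplicialVertexSet V)
    {τ₀ : Finset E3} (hτ₀ : τ₀ ∈ facets V) (q : unitInterval → V → E3) (hq : Continuous q)
    (hq0 : ∀ v, q 0 v = v)
    (hlen : ∀ t, ∀ τ ∈ facets V, ∀ u v : V, (u : E3) ∈ τ → (v : E3) ∈ τ →
      dist (q t u) (q t v) = dist (u : E3) v)
    (hfix : ∀ t, ∀ v : V, (v : E3) ∈ τ₀ → q t v = v) : ∀ t v, q t v = v := by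
  set p : V → E3 := fun v => (v : E3) with hp
  have hclopen : IsClopen {t | q t = p} := by
    refine ⟨isClosed_eq hq continuous_const, isOpen_iff_mem_nhds.2 fun t₀ ht₀ => ?_⟩
    have ht₀ : q t₀ = p := ht₀
    have hcont : Filter.Tendsto (fun t => q t + p) (nhds t₀) (nhds fun v => (v : E3) + v) := by
      have : Continuous fun t => q t + p := by fun_prop
      have h := this.tendsto t₀
      rw [ht₀] at h
      exact h
    filter_upwards [hcont.eventually (hV.eventually_flex_eq_zero hτ₀)] with t ht
    have h0 := ht (q t - p) (by
      intro τ hτ u v hu hv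
      have h1 := hlen t τ hτ u v hu hv
      rw [dist_eq_norm, dist_eq_norm] at h1
      have h2 : inner ℝ (q t u - q t v) (q t u - q t v) =
          inner ℝ ((u : E3) - v) ((u : E3) - v) := by
        rw [real_inner_self_eq_norm_sq, real_inner_self_eq_norm_sq, h1]
      have e1 : (q t + p) u - (q t + p) v = (q t u - q t v) + ((u : E3) - v) := by
        simp only [Pi.add_apply, hp]
        abel
      have e2 : (q t - p) u - (q t - p) v = (q t u - q t v) - ((u : E3) - v) := by
        simp only [Pi.sub_apply, hp]
        abel
      rw [e1, e2, inner_add_left, inner_sub_right (q t u - q t v),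
        inner_sub_right ((u : E3) - v), h2]
      linarith [real_inner_comm (q t u - q t v) ((u : E3) - v)]) (by
      intro v hv
      rw [Pi.sub_apply, hfix t v hv, hp, sub_self])
    exact sub_eq_zero.1 h0
  have huniv := hclopen.eq_univ ⟨0, funext hq0⟩
  intro t v
  have : t ∈ {t | q t = p} := huniv ▸ Set.mem_univ t
  exact congrFun this v

/-! ### Isometries that follow a triangle -/

/-- The matrix whose rows are two vectors and their cross product. -/
def frameMatrix (b₁ b₂ : E3) : Matrix (Fin 3) (Fin 3) ℝ :=
  Matrix.of ![b₁.ofLp, b₂.ofLp, crossProduct b₁.ofLp b₂.ofLp]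

theorem continuous_frameMatrix {X : Type*} [TopologicalSpace X] {b₁ b₂ : X → E3}
    (h₁ : Continuous b₁) (h₂ : Continuous b₂) :
    Continuous fun t => frameMatrix (b₁ t) (b₂ t) := by
  have c₁ : ∀ i, Continuous fun t => (b₁ t).ofLp i := fun i => by fun_prop
  have c₂ : ∀ i, Continuous fun t => (b₂ t).ofLp i := fun i => by fun_prop
  refine continuous_matrix fun i j => ?_
  fin_cases i
  · exact c₁ j
  · exact c₂ j
  · simp only [frameMatrix, cross_apply]
    fin_cases j
    · exact ((c₁ 1).mul (c₂ 2)).sub ((c₁ 2).mul (c₂ 1))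
    · exact ((c₁ 2).mul (c₂ 0)).sub ((c₁ 0).mul (c₂ 2))
    · exact ((c₁ 0).mul (c₂ 1)).sub ((c₁ 1).mul (c₂ 0))

theorem inner_eq_sum_three (x y : E3) :
    inner ℝ x y = x.ofLp 0 * y.ofLp 0 + x.ofLp 1 * y.ofLp 1 + x.ofLp 2 * y.ofLp 2 := by
  simp [PiLp.inner_apply, Fin.sum_univ_three, mul_comm]

open Matrix in
theorem frameMatrix_mul_transpose (b₁ b₂ : E3) :
    frameMatrix b₁ b₂ * (frameMatrix b₁ b₂)ᵀ =
      !![inner ℝ b₁ b₁, inner ℝ b₁ b₂, 0; inner ℝ b₁ b₂, inner ℝ b₂ b₂, 0;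
        0, 0, inner ℝ b₁ b₁ * inner ℝ b₂ b₂ - inner ℝ b₁ b₂ * inner ℝ b₁ b₂] := by
  simp only [inner_eq_sum_three]
  ext i j
  fin_cases i <;> fin_cases j <;>
    simp [frameMatrix, Matrix.mul_apply, Fin.sum_univ_three, cross_apply] <;> ring

theorem det_frameMatrix (b₁ b₂ : E3) : (frameMatrix b₁ b₂).det =
    inner ℝ b₁ b₁ * inner ℝ b₂ b₂ - inner ℝ b₁ b₂ * inner ℝ b₁ b₂ := by
  simp only [inner_eq_sum_three]
  simp [frameMatrix, Matrix.det_fin_three, cross_apply]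
  ring

theorem gram_det_ne_zero {b₁ b₂ : E3} (h₁ : b₁ ≠ 0) (h : b₂ ∉ Submodule.span ℝ {b₁}) :
    inner ℝ b₁ b₁ * inner ℝ b₂ b₂ - inner ℝ b₁ b₂ * inner ℝ b₁ b₂ ≠ (0 : ℝ) := by
  intro h0
  have hb : inner ℝ b₁ b₁ ≠ (0 : ℝ) := inner_self_ne_zero.2 h₁
  have hw : (inner ℝ b₁ b₁ : ℝ) • b₂ - (inner ℝ b₁ b₂ : ℝ) • b₁ = 0 := by
    rw [← inner_self_eq_zero (𝕜 := ℝ)]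
    simp only [inner_sub_left, inner_sub_right, real_inner_smul_left, real_inner_smul_right]
    rw [real_inner_comm b₁ b₂]
    linear_combination (inner ℝ b₁ b₁ : ℝ) * h0
  apply h
  rw [Submodule.mem_span_singleton]
  refine ⟨(inner ℝ b₁ b₁)⁻¹ * inner ℝ b₁ b₂, ?_⟩
  rw [mul_smul, ← sub_eq_zero.1 hw, smul_smul, inv_mul_cancel₀ hb, one_smul]

open Matrix in
/-- The linear map that takes the frame of `b₁, b₂` to the frame of `c₁, c₂`. -/
noncomputable def frameRotation (b₁ b₂ c₁ c₂ : E3) : Matrix (Fin 3) (Fin 3) ℝ :=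
  (frameMatrix c₁ c₂)ᵀ * ((frameMatrix b₁ b₂)ᵀ)⁻¹

open Matrix in
/-- Frames with the same Gram matrix differ by a rotation. -/
theorem exists_linearIsometryEquiv_frameRotation {b₁ b₂ c₁ c₂ : E3}
    (hdet : (frameMatrix b₁ b₂).det ≠ 0) (h₁₁ : inner ℝ c₁ c₁ = (inner ℝ b₁ b₁ : ℝ))
    (h₁₂ : inner ℝ c₁ c₂ = (inner ℝ b₁ b₂ : ℝ)) (h₂₂ : inner ℝ c₂ c₂ = (inner ℝ b₂ b₂ : ℝ)) :
    ∃ e : E3 ≃ₗᵢ[ℝ] E3, (∀ x, e x = Matrix.toEuclideanLin (frameRotation b₁ b₂ c₁ c₂) x) ∧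
      LinearMap.det (e.toLinearEquiv : E3 →ₗ[ℝ] E3) = 1 ∧ e b₁ = c₁ ∧ e b₂ = c₂ := by
  set R := frameMatrix b₁ b₂ with hR
  set S := frameMatrix c₁ c₂ with hS
  set M := frameRotation b₁ b₂ c₁ c₂ with hM
  have hRt : IsUnit Rᵀ.det := by
    rw [Matrix.det_transpose]
    exact isUnit_iff_ne_zero.2 hdet
  have hM' : M * Rᵀ = Sᵀ := by
    rw [hM, frameRotation, Matrix.mul_assoc, Matrix.nonsing_inv_mul _ hRt, Matrix.mul_one]
  have hgram : S * Sᵀ = R * Rᵀ := by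
    rw [hR, hS, frameMatrix_mul_transpose, frameMatrix_mul_transpose, h₁₁, h₁₂, h₂₂]
  have horth : Mᵀ * M = 1 := by
    have h : R * (Mᵀ * M) * Rᵀ = R * 1 * Rᵀ := by
      rw [Matrix.mul_one, ← hgram, ← hM', Matrix.mul_assoc, Matrix.mul_assoc, hM',
        ← Matrix.mul_assoc, show R * Mᵀ = (M * Rᵀ)ᵀ by simp, hM', Matrix.transpose_transpose]
    have hRu : IsUnit R.det := isUnit_iff_ne_zero.2 hdet
    have h' := congrArg (fun A => R⁻¹ * (A * (Rᵀ)⁻¹)) h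
    simpa only [Matrix.mul_nonsing_inv_cancel_right _ _ hRt,
      Matrix.nonsing_inv_mul_cancel_left _ _ hRu] using h'
  have hMdet : M.det = 1 := by
    have h := congrArg Matrix.det hM'
    have hSR : S.det = R.det := by
      rw [hS, hR, det_frameMatrix, det_frameMatrix, h₁₁, h₁₂, h₂₂]
    rw [Matrix.det_mul, Matrix.det_transpose, Matrix.det_transpose, hSR] at h
    exact (mul_eq_right₀ hdet).1 h
  have hinner : ∀ x y : E3, inner ℝ (Matrix.toEuclideanLin M x) (Matrix.toEuclideanLin M y) =
      (inner ℝ x y : ℝ) := by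
    intro x y
    rw [EuclideanSpace.inner_eq_star_dotProduct, EuclideanSpace.inner_eq_star_dotProduct]
    simp only [Matrix.ofLp_toLpLin, Matrix.toLin'_apply, star_trivial]
    rw [Matrix.dotProduct_mulVec, Matrix.vecMul_mulVec, horth, Matrix.vecMul_one]
  have hframe : ∀ i, Matrix.toEuclideanLin M (WithLp.toLp 2 (R i)) = WithLp.toLp 2 (S i) := by
    intro i
    rw [Matrix.toLpLin_apply]
    congr 1
    ext j
    exact congrFun (congrFun hM' j) i
  let e : E3 ≃ₗᵢ[ℝ] E3 :=
    ((Matrix.toEuclideanLin M).isometryOfInner hinner).toLinearIsometryEquiv rfl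
  have he : ∀ x, e x = Matrix.toEuclideanLin M x := fun x => rfl
  refine ⟨e, he, ?_, ?_, ?_⟩
  · have : (e.toLinearEquiv : E3 →ₗ[ℝ] E3) = Matrix.toEuclideanLin M := LinearMap.ext he
    rw [this, LinearMap.det_toLpLin, hMdet]
  · exact hframe 0
  · exact hframe 1

/-- Three noncollinear points that move with constant distances are carried along by a continuous
family of orientation-preserving isometries. -/
theorem exists_isometry_family {x y z : unitInterval → E3} (hx : Continuous x) (hy : Continuous y)
    (hz : Continuous z) (hxy : ∀ t, dist (x t) (y t) = dist (x 0) (y 0))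
    (hxz : ∀ t, dist (x t) (z t) = dist (x 0) (z 0))
    (hyz : ∀ t, dist (y t) (z t) = dist (y 0) (z 0)) (hne : y 0 ≠ x 0)
    (hn : z 0 - x 0 ∉ Submodule.span ℝ {y 0 - x 0}) :
    ∃ g : unitInterval → (E3 ≃ᵃⁱ[ℝ] E3), g 0 = AffineIsometryEquiv.refl ℝ E3 ∧
      (∀ p : E3, Continuous fun t => g t p) ∧
      (∀ t, LinearMap.det ((g t).linearIsometryEquiv.toLinearEquiv : E3 →ₗ[ℝ] E3) = 1) ∧
      ∀ t, g t (x 0) = x t ∧ g t (y 0) = y t ∧ g t (z 0) = z t := by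
  have hdet : (frameMatrix (y 0 - x 0) (z 0 - x 0)).det ≠ 0 := by
    rw [det_frameMatrix]
    exact gram_det_ne_zero (sub_ne_zero.2 hne) hn
  have hself : ∀ (u v : unitInterval → E3) (t : unitInterval),
      dist (u t) (v t) = dist (u 0) (v 0) →
      inner ℝ (v t - u t) (v t - u t) = (inner ℝ (v 0 - u 0) (v 0 - u 0) : ℝ) := by
    intro u v t h
    rw [real_inner_self_eq_norm_sq, real_inner_self_eq_norm_sq, ← dist_eq_norm, ← dist_eq_norm,
      dist_comm (v t), dist_comm (v 0), h]
  have h₁₂ : ∀ t, inner ℝ (y t - x t) (z t - x t) = (inner ℝ (y 0 - x 0) (z 0 - x 0) : ℝ) := by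
    have polar : ∀ t, 2 * (inner ℝ (y t - x t) (z t - x t) : ℝ) =
        inner ℝ (y t - x t) (y t - x t) + inner ℝ (z t - x t) (z t - x t) -
          inner ℝ (z t - y t) (z t - y t) := by
      intro t
      rw [show z t - y t = (z t - x t) - (y t - x t) by abel]
      generalize z t - x t = b
      generalize y t - x t = a
      rw [inner_sub_left, inner_sub_right, inner_sub_right]
      linarith [real_inner_comm a b]
    intro t
    have h1 := polar t
    rw [hself x y t (hxy t), hself x z t (hxz t), hself y z t (hyz t), ← polar 0] at h1
    linarith
  choose e he hedet hey hez using fun t =>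
    exists_linearIsometryEquiv_frameRotation (c₁ := y t - x t) (c₂ := z t - x t) hdet
      (hself x y t (hxy t)) (h₁₂ t) (hself x z t (hxz t))
  let g : unitInterval → (E3 ≃ᵃⁱ[ℝ] E3) := fun t =>
    AffineIsometryEquiv.mk' (fun p => e t (p - x 0) + x t) (e t) (x 0) (fun p => by simp)
  have hg : ∀ t p, g t p = e t (p - x 0) + x t := fun t p => rfl
  have hrot : Continuous fun t => frameRotation (y 0 - x 0) (z 0 - x 0) (y t - x t) (z t - x t) :=
    ((continuous_frameMatrix (hy.sub hx) (hz.sub hx)).matrix_transpose).mul continuous_const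
  refine ⟨g, ?_, ?_, ?_, ?_⟩
  · have hone : frameRotation (y 0 - x 0) (z 0 - x 0) (y 0 - x 0) (z 0 - x 0) = 1 := by
      rw [frameRotation, Matrix.mul_nonsing_inv]
      rw [Matrix.det_transpose]
      exact isUnit_iff_ne_zero.2 hdet
    ext1 p
    rw [hg, he, hone, Matrix.toLpLin_one]
    simp
  · intro p
    simp only [hg, he, Matrix.toLpLin_apply]
    refine Continuous.add ?_ hx
    exact (PiLp.continuous_toLp 2 _).comp (hrot.matrix_mulVec continuous_const)
  · intro t
    simp only [g, AffineIsometryEquiv.linearIsometryEquiv_mk']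
    exact hedet t
  · intro t
    refine ⟨?_, ?_, ?_⟩
    · simp [hg]
    · simp only [hg, hey, sub_add_cancel]
    · simp only [hg, hez, sub_add_cancel]

/-! ### Continuous rigidity -/

theorem mainTheorem2 (P : Set E3) (hP : Polytope3.IsConvexPolytope P)
    (hs : Polytope3.IsSimplicial P) : Polytope3.IsContinuouslyRigid P := by
  classical
  intro D
  set V : Finset E3 := hP.finite_vertices.toFinset with hVdef
  have hV : (V : Set E3) = Polytope3.vertices P := hP.finite_vertices.coe_toFinset
  have mem : ∀ x, x ∈ V ↔ x ∈ Polytope3.vertices P := fun x => by rw [← hV, Finset.mem_coe]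
  have hS := Polytope3.simplicialVertexSet hP hs hV
  obtain ⟨τ₀, hτ₀⟩ := hS.facets_nonempty
  obtain ⟨hcard, hsub, -⟩ := mem_facets.1 hτ₀
  obtain ⟨x, y, z, hxy, hxz, hyz, hτeq⟩ := Finset.card_eq_three.1 hcard
  have hx : x ∈ τ₀ := by simp [hτeq]
  have hy : y ∈ τ₀ := by simp [hτeq]
  have hz : z ∈ τ₀ := by simp [hτeq]
  let r : unitInterval → V → E3 := fun t v => D.vert t ⟨v, (mem v).1 v.2⟩
  have hr : ∀ v, Continuous fun t => r t v := fun v => D.continuous_vert _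
  have hr0 : ∀ v, r 0 v = v := fun v => D.vert_zero _
  have hlen : ∀ t, ∀ τ ∈ facets V, ∀ u v : V, (u : E3) ∈ τ → (v : E3) ∈ τ →
      dist (r t u) (r t v) = dist (u : E3) v := by
    intro t τ hτ u v hu hv
    rcases eq_or_ne u v with rfl | huv
    · simp
    · exact D.edge_length t _ _ (Polytope3.isEdge_of_mem_facets hP hs hV hτ hu hv
        fun h => huv (Subtype.ext h))
  let x' : V := ⟨x, hsub hx⟩
  let y' : V := ⟨y, hsub hy⟩
  let z' : V := ⟨z, hsub hz⟩
  obtain ⟨g, hg0, hgcont, hgdet, hgτ⟩ := exists_isometry_family (hr x') (hr y') (hr z')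
    (fun t => by rw [hlen t τ₀ hτ₀ x' y' hx hy, hr0, hr0])
    (fun t => by rw [hlen t τ₀ hτ₀ x' z' hx hz, hr0, hr0])
    (fun t => by rw [hlen t τ₀ hτ₀ y' z' hy hz, hr0, hr0])
    (by rw [hr0, hr0]; exact hxy.symm)
    (by rw [hr0, hr0, hr0]; exact hS.sub_notMem_span (hsub hx) (hsub hy) (hsub hz) hxy hxz hyz)
  simp only [hr0] at hgτ
  -- in the frame moving with the facet, the vertices do not move
  have hrigid : ∀ t v, (g t).symm (r t v) = v := by
    refine hS.eq_of_continuous hτ₀ (fun t v => (g t).symm (r t v)) ?_ ?_ ?_ ?_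
    · refine continuous_pi fun v => continuous_iff_continuousAt.2 fun t₀ => ?_
      rw [ContinuousAt, tendsto_iff_dist_tendsto_zero]
      have h : ∀ t, dist ((g t).symm (r t v)) ((g t₀).symm (r t₀ v)) =
          dist (r t v) (g t ((g t₀).symm (r t₀ v))) := by
        intro t
        rw [← (g t).dist_map, (g t).apply_symm_apply]
      simp only [h]
      have hc := ((hr v).dist (hgcont ((g t₀).symm (r t₀ v)))).tendsto t₀
      simpa using hc
    · intro v
      simp only [hg0, hr0]
      rfl
    · intro t τ hτ u v hu hv
      rw [(g t).symm.dist_map]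
      exact hlen t τ hτ u v hu hv
    · intro t v hv
      rw [AffineIsometryEquiv.symm_apply_eq]
      rw [hτeq] at hv
      simp only [Finset.mem_insert, Finset.mem_singleton] at hv
      obtain ⟨e1, e2, e3⟩ := hgτ t
      rcases hv with h | h | h
      · rw [show v = x' from Subtype.ext h]; exact e1.symm
      · rw [show v = y' from Subtype.ext h]; exact e2.symm
      · rw [show v = z' from Subtype.ext h]; exact e3.symm
  have hvert : ∀ t, ∀ v : Polytope3.vertices P, D.vert t v = g t v := by
    intro t v
    have h := hrigid t ⟨v, (mem v).2 v.2⟩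
    rw [AffineIsometryEquiv.symm_apply_eq] at h
    exact h
  refine ⟨g, hg0, hgcont, hgdet, fun t => ?_, hvert⟩
  rw [← (D.isConvexPolytope t).convexHull_vertices, ← (D.sameCombinatorics t).2.1]
  conv_rhs => rw [← hP.convexHull_vertices]
  have himage := AffineMap.image_convexHull (𝕜 := ℝ) (g t).toAffineEquiv.toAffineMap
    (Polytope3.vertices P)
  refine Eq.trans ?_ himage.symm
  congr 1
  ext p
  constructor
  · rintro ⟨v, rfl⟩
    exact ⟨v, v.2, (hvert t v).symm⟩
  · rintro ⟨v, hv, rfl⟩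
    exact ⟨⟨v, hv⟩, hvert t ⟨v, hv⟩⟩
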